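/- Let $m\in\mathbb{N}$ and $\Delta>0$, and let $Q_\Delta:\mathbb{R}^m\to\Delta\mathbb{Z}^m$ be the element-wise uniform quantizer, $[Q_\Delta(x)]_i=k\Delta$ if $[x]_i\in[k\Delta-\Delta/2,k\Delta+\Delta/2)$, $k\in\mathbb{Z}$. Let $z$ be a random vector in $\mathbb{R}^m$ with finite second moments, mean $\mathbb{E}[z]=z_\mu$ and covariance matrix $\mathbb{E}[(z-z_\mu)(z-z_\mu)^{\mathrm T}]=Z$. Let $\delta$ be a random vector, independent of $z$, whose $m$ entries are i.i.d. uniform on $[-\Delta/2,\Delta/2]$, and put $q=Q_\Delta(z+\delta)$. Let $n$ be a random vector, independent of $z$, whose entries are i.i.d. uniform on $[-\Delta/2,\Delta/2]$, and put $r=z+n$. Let $N=\frac{\Delta^2}{12}I_{m\times m}$, let $z^{\mathrm G}\sim\mathcal{N}(z_\mu,Z)$ and $n^{\mathrm G}\sim\mathcal{N}(0,N)$ be independent, and put $r^{\mathrm G}=z^{\mathrm G}+n^{\mathrm G}$. Here $H$ denotes the (conditional) Shannon entropy of a discrete random variable and $h$ the differential entropy, both in bits. Then $\mathbb{E}[n]=0$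 and $\mathbb{E}[nn^{\mathrm T}]=N$; $r^{\mathrm G}\sim\mathcal{N}(z_\mu,Z+N)$ and $h(r^{\mathrm G})=\frac12\log_2\det(2\pi e(N+Z))$; the differential entropies $h(r)$ and $h(n)$ exist and are finite; and $$H(q\mid\delta)=h(r)-h(n)\le h(r^{\mathrm G})-\tfrac12\log_2\det(2\pi eN)+\tfrac m2\log_2\!\Big(\frac{2\pi e}{12}\Big).$$ Furthermore, $$H(q)\le h(r^{\mathrm G})-\tfrac12\log_2\det(2\pi eN)+m\Big(1+\tfrac12\log_2\!\Big(\frac{2\pi e}{12}\Big)\Big).$$ -/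

import Mathlib

open MeasureTheory ProbabilityTheory
open scoped ENNReal

noncomputable section

namespace DitheredQuantization

/-- The set `Δ ℤ^m` of `m`-tuples of integer multiples of `Δ`. -/
abbrev stepLattice (m : ℕ) (Δ : ℝ) : Set (EuclideanSpace ℝ (Fin m)) :=
  Set.range fun k : Fin m → ℤ => WithLp.toLp 2 fun i => (k i : ℝ) * Δ

instance (m : ℕ) (Δ : ℝ) : Countable (stepLattice m Δ) :=
  (Set.countable_range _).to_subtype

/-- The element-wise uniform quantizer with step size `Δ`. Its `i`-th entry is `k Δ`, where `k` is
the integer with `x i ∈ [k Δ - Δ / 2, k Δ + Δ / 2)`. -/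
def quantizer {m : ℕ} (Δ : ℝ) (x : EuclideanSpace ℝ (Fin m)) : stepLattice m Δ :=
  ⟨WithLp.toLp 2 fun i => (⌊x i / Δ + 1 / 2⌋ : ℝ) * Δ, fun i => ⌊x i / Δ + 1 / 2⌋, rfl⟩

/-- The entries of the random vector `X` are independent and identically distributed, uniform on
`[-Δ / 2, Δ / 2]`. -/
def IsIIDUniform {Ω : Type*} [MeasurableSpace Ω] {m : ℕ} (Δ : ℝ)
    (X : Ω → EuclideanSpace ℝ (Fin m)) (P : Measure Ω) : Prop :=
  iIndepFun (fun i ω => X ω i) P ∧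
    ∀ i, pdf.IsUniform (fun ω => X ω i) (Set.Icc (-Δ / 2) (Δ / 2)) P volume

/-- Shannon entropy, in bits, of a probability measure on a countable alphabet. -/
def pmfEntropy {S : Type*} [Countable S] [MeasurableSpace S] [MeasurableSingletonClass S]
    (ν : Measure S) : ℝ≥0∞ :=
  ∑' s, ENNReal.ofReal (-(ν.real {s} * Real.logb 2 (ν.real {s})))

/-- The entropy `H(X)`, in bits, of a discrete random variable. -/
def entropy {Ω S : Type*} [MeasurableSpace Ω] [Countable S] [MeasurableSpace S]
    [MeasurableSingletonClass S] (X : Ω → S) (P : Measure Ω) : ℝ≥0∞ :=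
  pmfEntropy (P.map X)

/-- The conditional entropy `H(X | Y)`, in bits, of a discrete random variable `X` given an
arbitrary random variable `Y`: the average over `y`, with respect to the law of `Y`, of the entropy
of the conditional distribution of `X` given `Y = y`. -/
def condEntropy {Ω S T : Type*} [MeasurableSpace Ω] [Countable S] [Nonempty S] [MeasurableSpace S]
    [MeasurableSingletonClass S] [MeasurableSpace T] (X : Ω → S) (Y : Ω → T)
    (P : Measure Ω) [IsFiniteMeasure P] : ℝ≥0∞ :=
  ∫⁻ y, pmfEntropy (condDistrib X Y P y) ∂(P.map Y)

/-- The Lebesgue density of the law of a random vector (meaningful when the law is absolutely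
continuous). -/
def density {Ω : Type*} [MeasurableSpace Ω] {m : ℕ} (X : Ω → EuclideanSpace ℝ (Fin m))
    (P : Measure Ω) (x : EuclideanSpace ℝ (Fin m)) : ℝ :=
  ((P.map X).rnDeriv volume x).toReal

/-- The differential entropy of `X` exists and is finite: the law of `X` has a Lebesgue density `f`
and `f log f` is integrable. -/
def HasFiniteDiffEntropy {Ω : Type*} [MeasurableSpace Ω] {m : ℕ}
    (X : Ω → EuclideanSpace ℝ (Fin m)) (P : Measure Ω) : Prop :=
  P.map X ≪ volume ∧
    Integrable (fun x => density X P x * Real.logb 2 (density X P x)) volume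

/-- The differential entropy `h(X) = - ∫ f log₂ f`, in bits, where `f` is the Lebesgue density of
`X`. It is meaningful under `HasFiniteDiffEntropy X P`. -/
def diffEntropy {Ω : Type*} [MeasurableSpace Ω] {m : ℕ} (X : Ω → EuclideanSpace ℝ (Fin m))
    (P : Measure Ω) : ℝ :=
  -∫ x, density X P x * Real.logb 2 (density X P x)

end DitheredQuantization

end

/-! Fix the dither value `d`. The output is the lattice point `k` exactly when `z - (k - d)` lies in
the cell of the origin, so its probability is `p (k - d)`, where `p x` is the mass that the law of
`z` gives to the cell translated by `x` (`cellProb`). As `d` runs over one cell and `k` over the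
lattice, `k - d` sweeps out the space once, so averaging over `d` turns the sum over `k` into one
integral: `H(q | δ) = Δ^(-m) ∫ -p log₂ p` (`lintegral_cell_tsum`, `lintegral_pmfEntropy_quantizer`).
On the other side, `r = z + n` has density `p / Δ^m` (`conv_ditherLaw`). Hence `h(r)` is the same
integral plus `m log₂ Δ`, which is `h(n)`.

The first bound is Gaussian maximality (`neg_integral_mul_logb_le`): Gibbs' inequality against the
normal density with covariance `S = Z + N`. It needs only that the mean of the quadratic form of
`S⁻¹` under `r` is at most `m`. The constant `(m/2) log₂ (2πe/12)` is exactly the gap between the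
Gaussian entropy for `N` and `h(n)`.

For `H(q)`, dither `q` a second time with a fresh `u`. Since `q` is on the lattice, this leaves the
quantizer output unchanged (`lintegral_pmfEntropy_of_lattice`), so the identity above gives `H(q) =
h(q + u) - m log₂ Δ`. Now `q = z + e`, where given `z` the entries of `e` are independent, centred
and take two values `Δ` apart, hence have variance at most `Δ²/4`. The second moments of `q + u` are
thus dominated by `Z + (1/4 + 1/12) Δ² I = Z + 4N`, hence by `4S`, and replacing `S` by `4S` costs
`½ log₂ 4^m = m` bits (`entropy_quantizer_le`). -/

noncomputable section

namespace DitheredQuantization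

/-! ### Densities and sums of Gaussian laws -/

section

variable {m : ℕ}

/-- The quadratic form `v ↦ vᵀ A v`. -/
def quadForm (A : Matrix (Fin m) (Fin m) ℝ) (v : EuclideanSpace ℝ (Fin m)) : ℝ :=
  ∑ i, ∑ j, A i j * (v i * v j)

lemma quadForm_eq_dotProduct (A : Matrix (Fin m) (Fin m) ℝ) (v : EuclideanSpace ℝ (Fin m)) :
    quadForm A v = v.ofLp ⬝ᵥ A.mulVec v.ofLp := by
  simp only [quadForm, dotProduct, Matrix.mulVec, Finset.mul_sum]
  exact Finset.sum_congr rfl fun i _ => Finset.sum_congr rfl fun j _ => by ring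

lemma quadForm_nonneg {A : Matrix (Fin m) (Fin m) ℝ} (hA : A.PosSemidef)
    (v : EuclideanSpace ℝ (Fin m)) : 0 ≤ quadForm A v := by
  rw [quadForm_eq_dotProduct]
  simpa using hA.dotProduct_mulVec_nonneg v.ofLp

@[fun_prop]
lemma measurable_quadForm (A : Matrix (Fin m) (Fin m) ℝ) : Measurable (quadForm A) := by
  unfold quadForm
  fun_prop

/-- The Lebesgue density of the Gaussian law with mean `a` and covariance matrix `S`. -/
def gaussianDensity (a : EuclideanSpace ℝ (Fin m)) (S : Matrix (Fin m) (Fin m) ℝ)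
    (x : EuclideanSpace ℝ (Fin m)) : ℝ :=
  (√((2 * Real.pi) ^ m * S.det))⁻¹ * Real.exp (-quadForm S⁻¹ (x - a) / 2)

@[fun_prop]
lemma measurable_gaussianDensity (a : EuclideanSpace ℝ (Fin m))
    (S : Matrix (Fin m) (Fin m) ℝ) : Measurable (gaussianDensity a S) := by
  unfold gaussianDensity
  fun_prop

lemma gaussianDensity_pos (a : EuclideanSpace ℝ (Fin m)) {S : Matrix (Fin m) (Fin m) ℝ}
    (hS : S.PosDef) (x : EuclideanSpace ℝ (Fin m)) : 0 < gaussianDensity a S x := by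
  have := hS.det_pos
  unfold gaussianDensity
  positivity

lemma gaussianDensity_zero_one (x : EuclideanSpace ℝ (Fin m)) :
    gaussianDensity 0 1 x = (√((2 * Real.pi) ^ m))⁻¹ * Real.exp (-‖x‖ ^ 2 / 2) := by
  have h : ∑ i, x i * x i = ‖x‖ ^ 2 := by
    rw [EuclideanSpace.real_norm_sq_eq]
    exact Finset.sum_congr rfl fun i _ => (pow_two _).symm
  simp [gaussianDensity, quadForm_eq_dotProduct, dotProduct, h]

lemma lintegral_gaussianDensity_zero_one :
    ∫⁻ x : EuclideanSpace ℝ (Fin m), ENNReal.ofReal (gaussianDensity 0 1 x) = 1 := by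
  have h := GaussianFourier.integral_rexp_neg_mul_sq_norm (V := EuclideanSpace ℝ (Fin m))
    (b := 1 / 2) (by norm_num)
  have hpos : 0 < √((2 * Real.pi) ^ m) := by positivity
  have h2 : ∫ x : EuclideanSpace ℝ (Fin m), Real.exp (-‖x‖ ^ 2 / 2) = √((2 * Real.pi) ^ m) := by
    rw [finrank_euclideanSpace_fin] at h
    rw [Real.sqrt_eq_rpow, ← Real.rpow_natCast, ← Real.rpow_mul (by positivity), mul_one_div,
      show 2 * Real.pi = Real.pi / (1 / 2) by ring, ← h]
    congr 1 with x
    congr 1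
    ring
  have hint : Integrable fun x : EuclideanSpace ℝ (Fin m) => Real.exp (-‖x‖ ^ 2 / 2) := by
    -- The integral of a non-integrable function is `0` by convention, so the nonzero value in `h2`
    -- already forces integrability.
    by_contra hc
    rw [integral_undef hc] at h2
    exact hpos.ne h2
  simp_rw [gaussianDensity_zero_one]
  rw [← ofReal_integral_eq_lintegral_ofReal (hint.const_mul _)
    (Filter.Eventually.of_forall fun x => by positivity), integral_const_mul, h2,
    inv_mul_cancel₀ hpos.ne', ENNReal.ofReal_one]

/-- Both sides have characteristic function `exp (-‖t‖² / 2)`; for the density this is the Gaussian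
Fourier integral with `b = 1 / 2`. -/
lemma stdGaussian_eq_withDensity :
    stdGaussian (EuclideanSpace ℝ (Fin m)) =
      volume.withDensity fun x => ENNReal.ofReal (gaussianDensity 0 1 x) := by
  have : IsProbabilityMeasure ((volume : Measure (EuclideanSpace ℝ (Fin m))).withDensity
      fun x => ENNReal.ofReal (gaussianDensity 0 1 x)) :=
    ⟨by rw [withDensity_apply _ .univ, setLIntegral_univ, lintegral_gaussianDensity_zero_one]⟩
  apply Measure.ext_of_charFun
  ext t
  have h := GaussianFourier.integral_cexp_neg_mul_sq_norm_add (V := EuclideanSpace ℝ (Fin m))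
    (b := 1 / 2) (by norm_num) Complex.I t
  have hpos : 0 < √((2 * Real.pi) ^ m) := by positivity
  have hroot : ((Real.pi : ℂ) / (1 / 2)) ^ ((m : ℂ) / 2) = ((√((2 * Real.pi) ^ m) : ℝ) : ℂ) := by
    rw [Real.sqrt_eq_rpow, ← Real.rpow_natCast, ← Real.rpow_mul (by positivity), mul_one_div,
      Complex.ofReal_cpow (by positivity)]
    congr 1
    · push_cast; ring
    · push_cast; ring
  rw [finrank_euclideanSpace_fin, hroot] at h
  rw [charFun_stdGaussian, charFun_apply,
    integral_withDensity_eq_integral_toReal_smul (by fun_prop) (by simp)]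
  have hpt : ∀ x : EuclideanSpace ℝ (Fin m),
      (ENNReal.ofReal (gaussianDensity 0 1 x)).toReal • Complex.exp (inner ℝ x t * Complex.I) =
      ((√((2 * Real.pi) ^ m) : ℝ) : ℂ)⁻¹ *
        Complex.exp (-(1 / 2) * (‖x‖ : ℂ) ^ 2 + Complex.I * (inner ℝ t x : ℝ)) := by
    intro x
    rw [ENNReal.toReal_ofReal (gaussianDensity_pos _ Matrix.PosDef.one x).le,
      gaussianDensity_zero_one, Complex.real_smul, Complex.exp_add, real_inner_comm]
    push_cast
    rw [mul_assoc]
    congr 3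
    · ring_nf
    · ring_nf
  simp_rw [hpt]
  rw [integral_const_mul, h, ← mul_assoc, inv_mul_cancel₀ (by exact_mod_cast hpos.ne'), one_mul]
  congr 1
  rw [Complex.I_sq]
  ring

-- The Gaussian law is the image of the standard one under `x ↦ a + √S x`. This is a change of
-- variables with Jacobian `det √S`, and `√S S⁻¹ √S = 1` carries one quadratic form to the other.
open scoped MatrixOrder in
lemma multivariateGaussian_eq_withDensity (a : EuclideanSpace ℝ (Fin m))
    {S : Matrix (Fin m) (Fin m) ℝ} (hS : S.PosDef) :
    multivariateGaussian a S =
      volume.withDensity fun x => ENNReal.ofReal (gaussianDensity a S x) := by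
  set B := CFC.sqrt S with hB
  have hBB : B * B = S := CFC.sqrt_mul_sqrt_self S hS.posSemidef.nonneg
  have hBpsd : B.PosSemidef := Matrix.nonneg_iff_posSemidef.mp (CFC.sqrt_nonneg S)
  have hdetS : B.det * B.det = S.det := by rw [← Matrix.det_mul, hBB]
  have hdet0 : B.det ≠ 0 := by
    intro h0
    have := hS.det_pos
    simp [← hdetS, h0] at this
  have hdet : 0 < B.det := lt_of_le_of_ne hBpsd.det_nonneg hdet0.symm
  have hBT : B.transpose = B := by simpa using hBpsd.isHermitian.eq
  have hBu : IsUnit B.det := hdet0.isUnit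
  have hinv : B * (S⁻¹ * B) = 1 := by
    rw [← hBB, Matrix.mul_inv_rev, Matrix.mul_assoc, Matrix.nonsing_inv_mul _ hBu, Matrix.mul_one,
      Matrix.mul_nonsing_inv _ hBu]
  let T : EuclideanSpace ℝ (Fin m) →L[ℝ] EuclideanSpace ℝ (Fin m) :=
    Matrix.toEuclideanCLM (𝕜 := ℝ) B
  have hTdet : LinearMap.det (T : EuclideanSpace ℝ (Fin m) →ₗ[ℝ] EuclideanSpace ℝ (Fin m)) =
      B.det :=
    LinearMap.det_toLin (EuclideanSpace.basisFun (Fin m) ℝ).toBasis B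
  have hquad : ∀ x, quadForm S⁻¹ (T x) = quadForm 1 x := by
    intro x
    rw [quadForm_eq_dotProduct, quadForm_eq_dotProduct, Matrix.ofLp_toEuclideanCLM,
      Matrix.mulVec_mulVec, ← Matrix.vecMul_transpose, hBT, ← Matrix.dotProduct_mulVec,
      Matrix.mulVec_mulVec, hinv]
  have hdens : ∀ x, gaussianDensity 0 1 x = B.det * gaussianDensity a S (a + T x) := by
    intro x
    unfold gaussianDensity
    rw [add_sub_cancel_left, hquad, inv_one, sub_zero, Matrix.det_one, mul_one, ← hdetS,
      Real.sqrt_mul (by positivity), Real.sqrt_mul_self hdet.le]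
    field_simp
  have hmapT : (volume : Measure (EuclideanSpace ℝ (Fin m))).map (fun x => a + T x) =
      ENNReal.ofReal B.det⁻¹ • volume := by
    have h1 := Measure.map_linearMap_addHaar_eq_smul_addHaar
      (volume : Measure (EuclideanSpace ℝ (Fin m))) (f := T.toLinearMap) (by rwa [hTdet])
    rw [hTdet, abs_of_pos (inv_pos.mpr hdet)] at h1
    have h2 : (fun x => a + T x) = (fun x => a + x) ∘ T := rfl
    rw [h2, ← Measure.map_map (measurable_const_add a) (by fun_prop)]
    change Measure.map _ (Measure.map T.toLinearMap _) = _
    rw [h1, Measure.map_smul, map_add_left_eq_self]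
  have hTm : Measurable fun x => a + T x := by fun_prop
  rw [multivariateGaussian, stdGaussian_eq_withDensity]
  change Measure.map (fun x => a + T x) _ = _
  ext s hs
  rw [Measure.map_apply hTm hs, withDensity_apply _ (hTm hs), withDensity_apply _ hs]
  simp_rw [hdens, ENNReal.ofReal_mul hdet.le]
  have h3 := setLIntegral_map (μ := volume) (f := fun x => ENNReal.ofReal B.det *
    ENNReal.ofReal (gaussianDensity a S x)) hs (by fun_prop) hTm
  rw [← h3, hmapT, Measure.restrict_smul, lintegral_smul_measure,
    lintegral_const_mul _ (by fun_prop), smul_eq_mul, ← mul_assoc,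
    ← ENNReal.ofReal_mul (by positivity),
    inv_mul_cancel₀ hdet0, ENNReal.ofReal_one, one_mul]

/-- Characteristic functions are used because the covariances may be singular: `Z` need not be
invertible, so `zG` may have no density. -/
lemma multivariateGaussian_conv {a b : EuclideanSpace ℝ (Fin m)}
    {S T : Matrix (Fin m) (Fin m) ℝ} (hS : S.PosSemidef) (hT : T.PosSemidef) :
    multivariateGaussian a S ∗ multivariateGaussian b T = multivariateGaussian (a + b) (S + T) := by
  apply Measure.ext_of_charFun
  ext t
  rw [charFun_conv, charFun_multivariateGaussian hS, charFun_multivariateGaussian hT,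
    charFun_multivariateGaussian (hS.add hT), ← Complex.exp_add, inner_add_right, Matrix.add_mulVec,
    dotProduct_add]
  congr 1
  push_cast
  ring

end

/-! ### Quadratic forms, differential entropy and Gaussian maximality -/

section

variable {m : ℕ}

lemma integrable_quadForm {Ω : Type*} [MeasurableSpace Ω] {P : Measure Ω}
    (A : Matrix (Fin m) (Fin m) ℝ) {X : Ω → EuclideanSpace ℝ (Fin m)}
    (hX : ∀ i j, Integrable (fun ω => X ω i * X ω j) P) :
    Integrable (fun ω => quadForm A (X ω)) P :=
  integrable_finsetSum _ fun i _ => integrable_finsetSum _ fun j _ => (hX i j).const_mul _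

lemma integral_quadForm {Ω : Type*} [MeasurableSpace Ω] {P : Measure Ω}
    (A : Matrix (Fin m) (Fin m) ℝ) {X : Ω → EuclideanSpace ℝ (Fin m)}
    (hX : ∀ i j, Integrable (fun ω => X ω i * X ω j) P) :
    ∫ ω, quadForm A (X ω) ∂P = ∑ i, ∑ j, A i j * ∫ ω, X ω i * X ω j ∂P := by
  refine (integral_finsetSum _ fun i _ =>
    integrable_finsetSum _ fun j _ => (hX i j).const_mul (A i j)).trans ?_
  refine Finset.sum_congr rfl fun i _ => ?_
  rw [integral_finsetSum _ fun j _ => (hX i j).const_mul _]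
  exact Finset.sum_congr rfl fun j _ => integral_const_mul _ _

/-- The sum is `tr (S⁻¹ S)` by symmetry of `S`. It is the mean of the quadratic form of `S⁻¹` at a
centred vector with covariance `S`. -/
lemma sum_inv_mul_self {S : Matrix (Fin m) (Fin m) ℝ} (hS : S.PosDef) :
    ∑ i, ∑ j, S⁻¹ i j * S i j = m := by
  have hsymm : ∀ i j, S i j = S j i := fun i j => by
    simpa using congrFun (congrFun hS.isHermitian.eq j) i
  have h : (S⁻¹ * S).trace = m := by
    rw [Matrix.nonsing_inv_mul _ hS.det_pos.ne'.isUnit]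
    simp
  rw [← h, Matrix.trace]
  refine Finset.sum_congr rfl fun i _ => ?_
  rw [Matrix.diag_apply, Matrix.mul_apply]
  exact Finset.sum_congr rfl fun j _ => by rw [hsymm i j]

lemma log_gaussianDensity (a : EuclideanSpace ℝ (Fin m)) {S : Matrix (Fin m) (Fin m) ℝ}
    (hS : S.PosDef) (x : EuclideanSpace ℝ (Fin m)) :
    Real.log (gaussianDensity a S x) =
      -(1 / 2 * Real.log ((2 * Real.pi) ^ m * S.det)) - quadForm S⁻¹ (x - a) / 2 := by
  have := hS.det_pos
  rw [gaussianDensity, Real.log_mul (by positivity) (by positivity), Real.log_inv, Real.log_exp,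
    Real.log_sqrt (by positivity)]
  ring

/-- The summand `m` comes from the factor `e` in `2πe`; it matches the mean of the quadratic form in
the Gaussian entropy. -/
lemma log_det_smul {S : Matrix (Fin m) (Fin m) ℝ} (hS : S.PosDef) :
    Real.log ((2 * Real.pi * Real.exp 1) • S).det =
      Real.log ((2 * Real.pi) ^ m * S.det) + m := by
  have := hS.det_pos
  rw [Matrix.det_smul, Fintype.card_fin, mul_pow, mul_right_comm,
    Real.log_mul (by positivity) (by positivity), Real.log_pow, Real.log_exp, mul_one]

lemma density_ae_eq {Ω : Type*} [MeasurableSpace Ω] {P : Measure Ω}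
    {X : Ω → EuclideanSpace ℝ (Fin m)} {f : EuclideanSpace ℝ (Fin m) → ℝ} (hf : Measurable f)
    (hf0 : ∀ x, 0 ≤ f x) (hX : P.map X = volume.withDensity fun x => ENNReal.ofReal (f x)) :
    density X P =ᵐ[volume] f := by
  have h := Measure.rnDeriv_withDensity volume hf.ennreal_ofReal
  filter_upwards [h] with x hx
  rw [density, hX, hx, ENNReal.toReal_ofReal (hf0 x)]

/-- Replaces the Radon–Nikodym derivative in the definition by an explicit everywhere-defined
version of the density. -/
lemma hasFiniteDiffEntropy_iff {Ω : Type*} [MeasurableSpace Ω] {P : Measure Ω}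
    {X : Ω → EuclideanSpace ℝ (Fin m)} {f : EuclideanSpace ℝ (Fin m) → ℝ} (hf : Measurable f)
    (hf0 : ∀ x, 0 ≤ f x) (hX : P.map X = volume.withDensity fun x => ENNReal.ofReal (f x)) :
    HasFiniteDiffEntropy X P ↔ Integrable fun x => f x * Real.logb 2 (f x) := by
  have h : P.map X ≪ volume := hX ▸ withDensity_absolutelyContinuous _ _
  rw [HasFiniteDiffEntropy, and_iff_right h]
  refine integrable_congr ?_
  filter_upwards [density_ae_eq hf hf0 hX] with x hx
  rw [hx]

lemma diffEntropy_eq {Ω : Type*} [MeasurableSpace Ω] {P : Measure Ω}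
    {X : Ω → EuclideanSpace ℝ (Fin m)} {f : EuclideanSpace ℝ (Fin m) → ℝ} (hf : Measurable f)
    (hf0 : ∀ x, 0 ≤ f x) (hX : P.map X = volume.withDensity fun x => ENNReal.ofReal (f x)) :
    diffEntropy X P = -∫ x, f x * Real.logb 2 (f x) := by
  rw [diffEntropy]
  congr 1
  refine integral_congr_ae ?_
  filter_upwards [density_ae_eq hf hf0 hX] with x hx
  rw [hx]

lemma integrable_withDensity_ofReal_iff {f g : EuclideanSpace ℝ (Fin m) → ℝ} (hf : Measurable f)
    (hf0 : ∀ x, 0 ≤ f x) :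
    Integrable g (volume.withDensity fun x => ENNReal.ofReal (f x)) ↔
      Integrable fun x => f x * g x := by
  rw [integrable_withDensity_iff hf.ennreal_ofReal (by simp)]
  simp_rw [ENNReal.toReal_ofReal (hf0 _), mul_comm]

lemma integral_withDensity_ofReal {f g : EuclideanSpace ℝ (Fin m) → ℝ} (hf : Measurable f)
    (hf0 : ∀ x, 0 ≤ f x) :
    ∫ x, g x ∂(volume.withDensity fun x => ENNReal.ofReal (f x)) = ∫ x, f x * g x := by
  rw [integral_withDensity_eq_integral_toReal_smul hf.ennreal_ofReal (by simp)]
  simp_rw [ENNReal.toReal_ofReal (hf0 _), smul_eq_mul]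

/-- The logarithm of a Gaussian density is a constant minus half a quadratic form, so the cross
entropy depends on `ρ` only through the mean of that form. -/
lemma integral_gaussian_mul_log {f : EuclideanSpace ℝ (Fin m) → ℝ}
    (hfm : Measurable f) (hf0 : ∀ x, 0 ≤ f x)
    {ρ : Measure (EuclideanSpace ℝ (Fin m))} [IsProbabilityMeasure ρ]
    (hρ : ρ = volume.withDensity fun x => ENNReal.ofReal (f x))
    (a : EuclideanSpace ℝ (Fin m)) {S : Matrix (Fin m) (Fin m) ℝ} (hS : S.PosDef)
    (hint : Integrable (fun x => quadForm S⁻¹ (x - a)) ρ) :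
    Integrable (fun x => f x * Real.log (gaussianDensity a S x)) ∧
      ∫ x, f x * Real.log (gaussianDensity a S x) =
        -(1 / 2 * Real.log ((2 * Real.pi) ^ m * S.det)) -
          (∫ x, quadForm S⁻¹ (x - a) ∂ρ) / 2 := by
  simp_rw [log_gaussianDensity a hS]
  rw [← integrable_withDensity_ofReal_iff hfm hf0, ← integral_withDensity_ofReal hfm hf0, ← hρ]
  refine ⟨(integrable_const _).sub (hint.div_const 2), ?_⟩
  rw [integral_sub (integrable_const _) (hint.div_const 2), integral_div, integral_const]
  simp

lemma integrable_of_withDensity {f : EuclideanSpace ℝ (Fin m) → ℝ}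
    (hfm : Measurable f) (hf0 : ∀ x, 0 ≤ f x)
    {ρ : Measure (EuclideanSpace ℝ (Fin m))} [IsProbabilityMeasure ρ]
    (hρ : ρ = volume.withDensity fun x => ENNReal.ofReal (f x)) :
    Integrable f ∧ ∫ x, f x = 1 := by
  have h1 := integrable_withDensity_ofReal_iff (g := fun _ => (1 : ℝ)) hfm hf0
  have h2 := integral_withDensity_ofReal (g := fun _ => (1 : ℝ)) hfm hf0
  rw [← hρ] at h1 h2
  simp only [mul_one] at h1 h2
  exact ⟨h1.mp (integrable_const _), by simpa using h2.symm⟩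

/-- Among all densities with given second moments the Gaussian one maximizes the differential
entropy. -/
lemma neg_integral_mul_logb_le {f : EuclideanSpace ℝ (Fin m) → ℝ}
    (hfm : Measurable f) (hf0 : ∀ x, 0 ≤ f x) {C : ℝ} (hfC : ∀ x, f x ≤ C)
    {ρ : Measure (EuclideanSpace ℝ (Fin m))} [IsProbabilityMeasure ρ]
    (hρ : ρ = volume.withDensity fun x => ENNReal.ofReal (f x))
    (a : EuclideanSpace ℝ (Fin m)) {S : Matrix (Fin m) (Fin m) ℝ} (hS : S.PosDef)
    (hint : Integrable (fun x => quadForm S⁻¹ (x - a)) ρ)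
    (hle : ∫ x, quadForm S⁻¹ (x - a) ∂ρ ≤ m) :
    Integrable (fun x => f x * Real.logb 2 (f x)) ∧
      -∫ x, f x * Real.logb 2 (f x) ≤
        1 / 2 * Real.logb 2 ((2 * Real.pi * Real.exp 1) • S).det := by
  obtain ⟨hf1, hf2⟩ := integrable_of_withDensity hfm hf0 hρ
  obtain ⟨hg1, hg2⟩ := integrable_of_withDensity (measurable_gaussianDensity a S)
    (fun x => (gaussianDensity_pos a hS x).le) (multivariateGaussian_eq_withDensity a hS)
  obtain ⟨hl1, hl2⟩ := integral_gaussian_mul_log hfm hf0 hρ a hS hint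
  -- Gibbs' inequality in pointwise form, from `log u ≤ u - 1` at `u = g / f`. Keeping `f - g`,
  -- whose integral is `0`, also provides an integrable minorant of `f log f`.
  have hlow : ∀ x, f x * Real.log (gaussianDensity a S x) + f x - gaussianDensity a S x ≤
      f x * Real.log (f x) := by
    intro x
    have hg := gaussianDensity_pos a hS x
    rcases (hf0 x).eq_or_lt with h | h
    · simp [← h, hg.le]
    · have := Real.log_le_sub_one_of_pos (div_pos hg h)
      rw [Real.log_div hg.ne' h.ne'] at this
      have h3 := mul_le_mul_of_nonneg_left this h.le
      have h4 : f x * (gaussianDensity a S x / f x - 1) = gaussianDensity a S x - f x := by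
        field_simp
      rw [h4] at h3
      linarith
  -- Boundedness of the density supplies the integrable majorant, so that finiteness of the entropy
  -- is proved along with the bound.
  have hupp : ∀ x, f x * Real.log (f x) ≤ f x * Real.log C := by
    intro x
    rcases (hf0 x).eq_or_lt with h | h
    · simp [← h]
    · exact mul_le_mul_of_nonneg_left (Real.log_le_log h (hfC x)) h.le
  have hlowint : Integrable fun x =>
      f x * Real.log (gaussianDensity a S x) + f x - gaussianDensity a S x :=
    (hl1.add hf1).sub hg1
  have hI : Integrable fun x => f x * Real.log (f x) :=
    integrable_of_le_of_le (by fun_prop) (Filter.Eventually.of_forall hlow)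
      (Filter.Eventually.of_forall hupp) hlowint (hf1.mul_const _)
  have hmono := integral_mono hlowint hI hlow
  have hadd : Integrable fun x => f x * Real.log (gaussianDensity a S x) + f x := hl1.add hf1
  rw [integral_sub hadd hg1, integral_add hl1 hf1, hf2, hg2, hl2] at hmono
  have hdiv : ∀ x, f x * Real.logb 2 (f x) = f x * Real.log (f x) / Real.log 2 := fun x => by
    rw [Real.logb, mul_div_assoc]
  simp_rw [hdiv]
  refine ⟨hI.div_const _, ?_⟩
  have hlog2 : 0 < Real.log 2 := Real.log_pos one_lt_two
  rw [integral_div, Real.logb, log_det_smul hS, ← neg_div, mul_div_assoc',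
    div_le_div_iff_of_pos_right hlog2]
  linarith

lemma integrable_mul_sub_of_memLp {Ω : Type*} [MeasurableSpace Ω] {P : Measure Ω}
    [IsFiniteMeasure P] {X : Ω → EuclideanSpace ℝ (Fin m)} (hX : MemLp X 2 P)
    (a : EuclideanSpace ℝ (Fin m)) (i j : Fin m) :
    Integrable (fun ω => (X ω - a) i * (X ω - a) j) P := by
  have h : MemLp (fun ω => X ω - a) 2 P := hX.sub (memLp_const a)
  exact (h.eval_piLp i).integrable_mul (h.eval_piLp j)

lemma integral_mul_sub_eq_covariance {Ω : Type*} [MeasurableSpace Ω] {P : Measure Ω}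
    [IsProbabilityMeasure P] {X : Ω → EuclideanSpace ℝ (Fin m)} (hX : MemLp X 2 P)
    {a : EuclideanSpace ℝ (Fin m)} (ha : ∫ ω, X ω ∂P = a) (i j : Fin m) :
    ∫ ω, (X ω - a) i * (X ω - a) j ∂P = cov[fun ω => X ω i, fun ω => X ω j; P] := by
  have h : ∀ i, ∫ ω, X ω i ∂P = a i := by
    intro i
    have := (EuclideanSpace.proj (𝕜 := ℝ) i).integral_comp_comm (hX.integrable (by norm_num))
    simpa [ha] using this
  simp [covariance, h]

/-- The differential entropy of a nondegenerate Gaussian law. -/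
lemma diffEntropy_multivariateGaussian {Ω : Type*} [MeasurableSpace Ω] {P : Measure Ω}
    {X : Ω → EuclideanSpace ℝ (Fin m)} {a : EuclideanSpace ℝ (Fin m)}
    {S : Matrix (Fin m) (Fin m) ℝ} (hS : S.PosDef) (hX : P.map X = multivariateGaussian a S) :
    HasFiniteDiffEntropy X P ∧
      diffEntropy X P = 1 / 2 * Real.logb 2 ((2 * Real.pi * Real.exp 1) • S).det := by
  have hρ := multivariateGaussian_eq_withDensity a hS
  have hgm := measurable_gaussianDensity a S
  have hg0 := fun x => (gaussianDensity_pos a hS x).le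
  have hmem : MemLp (fun x => x) 2 (multivariateGaussian a S) := IsGaussian.memLp_two_id
  have hsec := integrable_mul_sub_of_memLp hmem a
  have hquad : ∫ x, quadForm S⁻¹ (x - a) ∂(multivariateGaussian a S) = m := by
    rw [integral_quadForm _ hsec, ← sum_inv_mul_self hS]
    refine Finset.sum_congr rfl fun i _ => Finset.sum_congr rfl fun j _ => ?_
    rw [integral_mul_sub_eq_covariance hmem integral_id_multivariateGaussian,
      covariance_eval_multivariateGaussian hS.posSemidef]
  obtain ⟨h1, h2⟩ := integral_gaussian_mul_log hgm hg0 hρ a hS (integrable_quadForm _ hsec)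
  rw [hasFiniteDiffEntropy_iff hgm hg0 (hX.trans hρ), diffEntropy_eq hgm hg0 (hX.trans hρ)]
  simp_rw [Real.logb, mul_div_assoc']
  refine ⟨h1.div_const _, ?_⟩
  rw [integral_div, h2, hquad, log_det_smul hS]
  ring

end

/-! ### Cells, dither and the entropy identity -/

section

variable {m : ℕ} {Δ : ℝ}

/-- The quantization cell of the origin. -/
def cell (m : ℕ) (Δ : ℝ) : Set (EuclideanSpace ℝ (Fin m)) :=
  {x | ∀ i, x i ∈ Set.Ico (-Δ / 2) (Δ / 2)}

lemma measurableSet_cell : MeasurableSet (cell m Δ) := by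
  simp only [cell, Set.ofPred_forall]
  exact MeasurableSet.iInter fun i => measurableSet_Ico.preimage (by fun_prop)

lemma quantizer_eq_iff (hΔ : 0 < Δ) (x : EuclideanSpace ℝ (Fin m)) (k : stepLattice m Δ) :
    quantizer Δ x = k ↔ x - k ∈ cell m Δ := by
  obtain ⟨_, κ, rfl⟩ := k
  rw [Subtype.ext_iff]
  change WithLp.toLp 2 (fun i => (⌊x i / Δ + 1 / 2⌋ : ℝ) * Δ) = WithLp.toLp 2 _ ↔
    ∀ i, x i - (κ i : ℝ) * Δ ∈ Set.Ico (-Δ / 2) (Δ / 2)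
  rw [(WithLp.toLp_injective 2).eq_iff, funext_iff]
  refine forall_congr' fun i => ?_
  rw [mul_left_inj' hΔ.ne', Int.cast_inj, Int.floor_eq_iff, Set.mem_Ico]
  have h : x i / Δ * Δ = x i := by field_simp
  constructor
  · rintro ⟨h1, h2⟩
    have h3 := mul_le_mul_of_nonneg_right h1 hΔ.le
    have h4 := mul_lt_mul_of_pos_right h2 hΔ
    constructor <;> nlinarith
  · rintro ⟨h1, h2⟩
    constructor
    · refine le_of_mul_le_mul_right ?_ hΔ
      nlinarith
    · refine lt_of_mul_lt_mul_right ?_ hΔ.le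
      nlinarith

lemma measurable_quantizer (hΔ : 0 < Δ) :
    Measurable (quantizer Δ : EuclideanSpace ℝ (Fin m) → stepLattice m Δ) := by
  refine measurable_to_countable' fun k => ?_
  have : quantizer Δ ⁻¹' {k} = (fun x : EuclideanSpace ℝ (Fin m) => x - k) ⁻¹' cell m Δ := by
    ext x
    simp [quantizer_eq_iff hΔ]
  rw [this]
  exact measurableSet_cell.preimage (by fun_prop)

/-- Reduces questions about the faces of a cube to the null endpoints of an interval. -/
lemma volume_restrict_eq_map_pi (s : Set ℝ) :
    (volume : Measure (EuclideanSpace ℝ (Fin m))).restrict {x | ∀ i, x i ∈ s} =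
      (Measure.pi fun _ : Fin m => (volume : Measure ℝ).restrict s).map (WithLp.toLp 2) := by
  have hmp := (EuclideanSpace.volume_preserving_symm_measurableEquiv_toLp (Fin m)).symm
  rw [← Measure.restrict_pi_pi, ← volume_pi]
  have h := (hmp.restrict_preimage_emb (MeasurableEquiv.measurableEmbedding _)
    {x | ∀ i, x i ∈ s}).map_eq
  rw [← h]
  congr 2
  ext x
  simp

lemma restrict_Icc_cube_eq_cell :
    (volume : Measure (EuclideanSpace ℝ (Fin m))).restrict
      {x | ∀ i, x i ∈ Set.Icc (-Δ / 2) (Δ / 2)} = volume.restrict (cell m Δ) := by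
  rw [cell, volume_restrict_eq_map_pi, volume_restrict_eq_map_pi]
  simp_rw [Measure.restrict_congr_set Ico_ae_eq_Icc]

/-- Reflection moves only the included faces, which are null. The half-open cell may therefore be
treated as symmetric, as needed whenever the dither enters with a minus sign. -/
lemma restrict_neg_cell :
    (volume : Measure (EuclideanSpace ℝ (Fin m))).restrict {x | -x ∈ cell m Δ} =
      volume.restrict (cell m Δ) := by
  have : {x : EuclideanSpace ℝ (Fin m) | -x ∈ cell m Δ} =
      {x | ∀ i, x i ∈ Set.Ioc (-Δ / 2) (Δ / 2)} := by
    ext x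
    refine forall_congr' fun i => ?_
    simp only [PiLp.neg_apply, Set.mem_Ico, Set.mem_Ioc]
    constructor <;> rintro ⟨h1, h2⟩ <;> constructor <;> linarith
  rw [this, cell, volume_restrict_eq_map_pi, volume_restrict_eq_map_pi]
  simp_rw [Measure.restrict_congr_set Ico_ae_eq_Icc, Measure.restrict_congr_set Ioc_ae_eq_Icc]

lemma volume_cell : volume (cell m Δ) = ENNReal.ofReal Δ ^ m := by
  have h := congrArg (fun μ => μ Set.univ) (volume_restrict_eq_map_pi (m := m)
    (Set.Ico (-Δ / 2) (Δ / 2)))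
  rw [Measure.restrict_apply_univ] at h
  rw [cell, h, Measure.map_apply (by fun_prop) .univ, Set.preimage_univ, Measure.pi_univ]
  simp only [Measure.restrict_apply_univ, Real.volume_Ico, Finset.prod_const, Finset.card_univ,
    Fintype.card_fin]
  congr 2
  ring

/-- The uniform law on the quantization cell of the origin. -/
def ditherLaw (m : ℕ) (Δ : ℝ) : Measure (EuclideanSpace ℝ (Fin m)) :=
  (ENNReal.ofReal Δ ^ m)⁻¹ • volume.restrict (cell m Δ)

lemma isProbabilityMeasure_ditherLaw (hΔ : 0 < Δ) : IsProbabilityMeasure (ditherLaw m Δ) := by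
  refine ⟨?_⟩
  rw [ditherLaw, Measure.smul_apply, Measure.restrict_apply_univ, volume_cell, smul_eq_mul]
  exact ENNReal.inv_mul_cancel (by simp [hΔ]) (by simp)

lemma ditherLaw_eq_map_pi (hΔ : 0 < Δ) :
    ditherLaw m Δ = (Measure.pi fun _ : Fin m =>
      ProbabilityTheory.cond (volume : Measure ℝ) (Set.Icc (-Δ / 2) (Δ / 2))).map
        (WithLp.toLp 2) := by
  have hv : (volume : Measure ℝ) (Set.Icc (-Δ / 2) (Δ / 2)) = ENNReal.ofReal Δ := by
    rw [Real.volume_Icc]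
    congr 1
    ring
  have : IsProbabilityMeasure
      (ProbabilityTheory.cond (volume : Measure ℝ) (Set.Icc (-Δ / 2) (Δ / 2))) :=
    cond_isProbabilityMeasure_of_finite (by simp [hv, hΔ]) (by simp)
  rw [ditherLaw, ← restrict_Icc_cube_eq_cell, volume_restrict_eq_map_pi, ← Measure.map_smul]
  congr 1
  symm
  refine Measure.pi_eq fun s hs => ?_
  simp [ProbabilityTheory.cond, hv, Measure.pi_pi, Finset.prod_mul_distrib, ENNReal.inv_pow]

lemma IsIIDUniform.map_eq {Ω : Type*} [MeasurableSpace Ω] {P : Measure Ω} [IsProbabilityMeasure P]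
    (hΔ : 0 < Δ) {X : Ω → EuclideanSpace ℝ (Fin m)} (hX : Measurable X)
    (h : IsIIDUniform Δ X P) : P.map X = ditherLaw m Δ := by
  have h1 := (iIndepFun_iff_map_fun_eq_pi_map (f := fun i ω => X ω i)
    fun i => (by fun_prop)).mp h.1
  rw [ditherLaw_eq_map_pi hΔ]
  have h2 : (fun i => P.map fun ω => X ω i) = fun _ : Fin m =>
      ProbabilityTheory.cond (volume : Measure ℝ) (Set.Icc (-Δ / 2) (Δ / 2)) :=
    funext fun i => h.2 i
  rw [← h2, ← h1, Measure.map_map (by fun_prop) (by fun_prop)]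
  rfl

/-- The probability under `μ` of the translate by `x` of the quantization cell. -/
def cellProb (Δ : ℝ) (μ : Measure (EuclideanSpace ℝ (Fin m))) (x : EuclideanSpace ℝ (Fin m)) : ℝ :=
  μ.real {y | y - x ∈ cell m Δ}

lemma cellProb_nonneg {μ : Measure (EuclideanSpace ℝ (Fin m))} (x : EuclideanSpace ℝ (Fin m)) :
    0 ≤ cellProb Δ μ x := measureReal_nonneg

/-- Where the cell probability vanishes, its factor kills every term, so the logarithm need only be
split where it is positive. -/
lemma logb_cellProb_div {μ : Measure (EuclideanSpace ℝ (Fin m))} (hΔ : 0 < Δ)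
    (x : EuclideanSpace ℝ (Fin m)) :
    cellProb Δ μ x / Δ ^ m * Real.logb 2 (cellProb Δ μ x / Δ ^ m) =
      cellProb Δ μ x / Δ ^ m * Real.logb 2 (cellProb Δ μ x) -
        cellProb Δ μ x / Δ ^ m * (m * Real.logb 2 Δ) := by
  rcases (cellProb_nonneg (Δ := Δ) (μ := μ) x).eq_or_lt with h | h
  · simp [← h]
  · rw [Real.logb_div h.ne' (by positivity), Real.logb_pow]
    ring

variable {μ : Measure (EuclideanSpace ℝ (Fin m))} [IsProbabilityMeasure μ]

lemma cellProb_le_one (x : EuclideanSpace ℝ (Fin m)) : cellProb Δ μ x ≤ 1 := measureReal_le_one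

lemma measurableSet_sub_mem_cell : MeasurableSet
    {p : EuclideanSpace ℝ (Fin m) × EuclideanSpace ℝ (Fin m) | p.2 - p.1 ∈ cell m Δ} :=
  measurableSet_cell.preimage (by fun_prop)

@[fun_prop]
lemma measurable_cellProb : Measurable (cellProb Δ μ) :=
  (measurable_measure_prodMk_left measurableSet_sub_mem_cell).ennreal_toReal

/-- Adding independent dither to a random vector produces the density `cellProb Δ μ / Δ ^ m`. -/
lemma conv_ditherLaw (hΔ : 0 < Δ) :
    μ ∗ ditherLaw m Δ =
      volume.withDensity fun x => ENNReal.ofReal (cellProb Δ μ x / Δ ^ m) := by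
  have := isProbabilityMeasure_ditherLaw (m := m) hΔ
  have hdens : ∀ x, ENNReal.ofReal (cellProb Δ μ x / Δ ^ m) =
      (ENNReal.ofReal Δ ^ m)⁻¹ * μ {y | y - x ∈ cell m Δ} := by
    intro x
    rw [ENNReal.ofReal_div_of_pos (by positivity), cellProb, ofReal_measureReal,
      ENNReal.ofReal_pow hΔ.le, mul_comm, div_eq_mul_inv]
  ext s hs
  have hind : Measurable fun p : EuclideanSpace ℝ (Fin m) × EuclideanSpace ℝ (Fin m) =>
      s.indicator (1 : EuclideanSpace ℝ (Fin m) → ℝ≥0∞) p.2 *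
        (cell m Δ).indicator (1 : EuclideanSpace ℝ (Fin m) → ℝ≥0∞) (p.1 - p.2) :=
    ((measurable_one.indicator hs).comp measurable_snd).mul
      ((measurable_one.indicator measurableSet_cell).comp (by fun_prop))
  have hneg : MeasurableSet {x : EuclideanSpace ℝ (Fin m) | -x ∈ cell m Δ} :=
    measurableSet_cell.preimage measurable_neg
  have hinner : ∀ y, ∫⁻ d, s.indicator 1 (y + d) ∂(ditherLaw m Δ) =
      (ENNReal.ofReal Δ ^ m)⁻¹ *
        ∫⁻ x, s.indicator 1 x * (cell m Δ).indicator 1 (y - x) := by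
    intro y
    -- After reflection the substitution `x = y + d` turns `-d ∈ cell` into `y - x ∈ cell`, the
    -- condition that defines `cellProb`.
    rw [ditherLaw, ← restrict_neg_cell, lintegral_smul_measure, smul_eq_mul,
      ← lintegral_indicator hneg,
      ← lintegral_add_left_eq_self (fun x => s.indicator 1 x * (cell m Δ).indicator 1 (y - x)) y]
    congr 1
    refine lintegral_congr fun d => ?_
    by_cases hd : -d ∈ cell m Δ <;> simp [Set.indicator, hd]
  rw [← lintegral_indicator_one hs, Measure.lintegral_conv (measurable_one.indicator hs)]
  simp_rw [hinner]
  rw [lintegral_const_mul _ hind.lintegral_prod_right', lintegral_lintegral_swap hind.aemeasurable,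
    withDensity_apply _ hs, ← lintegral_indicator hs,
    ← lintegral_const_mul _ hind.lintegral_prod_left']
  refine lintegral_congr fun x => ?_
  have hset : ∫⁻ y, (cell m Δ).indicator 1 (y - x) ∂μ = μ {y | y - x ∈ cell m Δ} :=
    lintegral_indicator_one (s := {y | y - x ∈ cell m Δ})
      (measurableSet_cell.preimage (by fun_prop))
  by_cases hx : x ∈ s <;> simp [hx, hdens, hset]

/-- Integration over the whole space, cell by cell. -/
lemma lintegral_cell_tsum (hΔ : 0 < Δ) {F : EuclideanSpace ℝ (Fin m) → ℝ≥0∞} (hF : Measurable F) :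
    ∫⁻ d in cell m Δ, ∑' k : stepLattice m Δ, F (k - d) = ∫⁻ x, F x := by
  have hQ := measurable_quantizer (m := m) hΔ
  rw [lintegral_tsum fun k => by fun_prop]
  have hU : ⋃ k : stepLattice m Δ, quantizer (m := m) Δ ⁻¹' {k} = Set.univ := by
    rw [← Set.preimage_iUnion, Set.iUnion_of_singleton, Set.preimage_univ]
  have h1 : ∫⁻ x, F x = ∑' k : stepLattice m Δ, ∫⁻ x in quantizer (m := m) Δ ⁻¹' {k}, F x := by
    rw [← setLIntegral_univ, ← hU, lintegral_iUnion (fun k => hQ (measurableSet_singleton k))]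
    exact fun i j hij => Disjoint.preimage _ (by simpa using hij)
  rw [h1]
  refine tsum_congr fun k => ?_
  have hneg : MeasurableSet {x : EuclideanSpace ℝ (Fin m) | -x ∈ cell m Δ} :=
    measurableSet_cell.preimage measurable_neg
  rw [← restrict_neg_cell, ← lintegral_indicator hneg,
    ← lintegral_indicator (hQ (measurableSet_singleton k)),
    ← lintegral_sub_left_eq_self (Set.indicator _ F) (k : EuclideanSpace ℝ (Fin m))]
  refine lintegral_congr fun d => ?_
  -- The preimage of `k` is `k` plus the cell, so `k - d` lies in it exactly when `-d` is in the
  -- cell.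
  have : k.1 - d ∈ quantizer (m := m) Δ ⁻¹' {k} ↔ d ∈ {x | -x ∈ cell m Δ} := by
    simp [quantizer_eq_iff hΔ]
  by_cases hd : d ∈ {x : EuclideanSpace ℝ (Fin m) | -x ∈ cell m Δ}
  · rw [Set.indicator_of_mem hd, Set.indicator_of_mem (this.mpr hd)]
  · rw [Set.indicator_of_notMem hd, Set.indicator_of_notMem (this.not.mpr hd)]

/-- The entropy of the dithered quantizer output, averaged over the dither, is an integral of the
cell probabilities over the whole space. -/
lemma lintegral_pmfEntropy_quantizer (hΔ : 0 < Δ) :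
    ∫⁻ d, pmfEntropy (μ.map fun y => quantizer Δ (y + d)) ∂(ditherLaw m Δ) =
      ∫⁻ x, ENNReal.ofReal (-(cellProb Δ μ x / Δ ^ m * Real.logb 2 (cellProb Δ μ x))) := by
  have hQ := measurable_quantizer (m := m) hΔ
  have hp : ∀ (d : EuclideanSpace ℝ (Fin m)) (k : stepLattice m Δ),
      (μ.map fun y => quantizer Δ (y + d)).real {k} = cellProb Δ μ (k - d) := by
    intro d k
    have hQd : Measurable fun y => quantizer Δ (y + d) := hQ.comp (by fun_prop)
    rw [map_measureReal_apply hQd (measurableSet_singleton k), cellProb]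
    congr 1
    ext y
    simp [quantizer_eq_iff hΔ, sub_sub_eq_add_sub]
  simp_rw [pmfEntropy, hp]
  rw [ditherLaw, lintegral_smul_measure, lintegral_cell_tsum hΔ
    (F := fun x => ENNReal.ofReal (-(cellProb Δ μ x * Real.logb 2 (cellProb Δ μ x))))
    (by unfold Real.logb; fun_prop), smul_eq_mul,
    ← lintegral_const_mul _ (by unfold Real.logb; fun_prop)]
  refine lintegral_congr fun x => ?_
  rw [← ENNReal.ofReal_pow hΔ.le, ← ENNReal.ofReal_inv_of_pos (by positivity),
    ← ENNReal.ofReal_mul (by positivity)]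
  congr 1
  ring

/-- The averaged entropy of the dithered quantizer output equals the differential entropy of the
smoothed law, minus that of the dither. -/
lemma lintegral_pmfEntropy_quantizer_eq_ofReal (hΔ : 0 < Δ)
    (hint : Integrable fun x => cellProb Δ μ x / Δ ^ m * Real.logb 2 (cellProb Δ μ x / Δ ^ m)) :
    0 ≤ -(∫ x, cellProb Δ μ x / Δ ^ m * Real.logb 2 (cellProb Δ μ x / Δ ^ m)) -
        m * Real.logb 2 Δ ∧
    ∫⁻ d, pmfEntropy (μ.map fun y => quantizer Δ (y + d)) ∂(ditherLaw m Δ) =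
      ENNReal.ofReal
        (-(∫ x, cellProb Δ μ x / Δ ^ m * Real.logb 2 (cellProb Δ μ x / Δ ^ m)) -
          m * Real.logb 2 Δ) := by
  have := isProbabilityMeasure_ditherLaw (m := m) hΔ
  obtain ⟨hf1, hf2⟩ := integrable_of_withDensity (by fun_prop)
    (fun x => div_nonneg (cellProb_nonneg x) (by positivity)) (conv_ditherLaw (μ := μ) hΔ)
  have hpt : ∀ x, -(cellProb Δ μ x / Δ ^ m * Real.logb 2 (cellProb Δ μ x)) =
      -(cellProb Δ μ x / Δ ^ m * Real.logb 2 (cellProb Δ μ x / Δ ^ m)) -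
        cellProb Δ μ x / Δ ^ m * (m * Real.logb 2 Δ) := fun x => by
    rw [logb_cellProb_div hΔ]
    ring
  have hnn : ∀ x, 0 ≤ -(cellProb Δ μ x / Δ ^ m * Real.logb 2 (cellProb Δ μ x)) := fun x => by
    have h0 := cellProb_nonneg (Δ := Δ) (μ := μ) x
    have h1 := Real.logb_nonpos one_lt_two h0 (cellProb_le_one x)
    have h2 : 0 ≤ cellProb Δ μ x / Δ ^ m := by positivity
    nlinarith
  have hI : Integrable fun x => -(cellProb Δ μ x / Δ ^ m * Real.logb 2 (cellProb Δ μ x)) := by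
    simp_rw [hpt]
    exact hint.neg.sub (hf1.mul_const _)
  have heq : ∫ x, -(cellProb Δ μ x / Δ ^ m * Real.logb 2 (cellProb Δ μ x)) =
      -(∫ x, cellProb Δ μ x / Δ ^ m * Real.logb 2 (cellProb Δ μ x / Δ ^ m)) -
          m * Real.logb 2 Δ := by
    simp_rw [hpt]
    rw [integral_sub hint.fun_neg (hf1.mul_const _), integral_neg, integral_mul_const, hf2, one_mul]
  -- Once rewritten as the integral of `-p log₂ p / Δ^m`, with `0 ≤ p ≤ 1`, the quantity is visibly
  -- nonnegative, so `ENNReal.ofReal` loses nothing.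
  rw [← heq]
  refine ⟨integral_nonneg hnn, ?_⟩
  rw [lintegral_pmfEntropy_quantizer hΔ,
    ofReal_integral_eq_lintegral_ofReal hI (Filter.Eventually.of_forall hnn)]

end

/-! ### Moments of the dither and of entrywise noise -/

section

variable {m : ℕ} {Δ : ℝ}

/-- Lets the moment lemmas for i.i.d. uniform vectors be applied to the coordinates under
`ditherLaw` itself. -/
lemma isIIDUniform_id (hΔ : 0 < Δ) : IsIIDUniform Δ id (ditherLaw m Δ) := by
  have hv : (volume : Measure ℝ) (Set.Icc (-Δ / 2) (Δ / 2)) = ENNReal.ofReal Δ := by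
    rw [Real.volume_Icc]
    congr 1
    ring
  have : IsProbabilityMeasure
      (ProbabilityTheory.cond (volume : Measure ℝ) (Set.Icc (-Δ / 2) (Δ / 2))) :=
    cond_isProbabilityMeasure_of_finite (by simp [hv, hΔ]) (by simp)
  have := isProbabilityMeasure_ditherLaw (m := m) hΔ
  have hev : ∀ i, (ditherLaw m Δ).map (fun x => x i) =
      ProbabilityTheory.cond (volume : Measure ℝ) (Set.Icc (-Δ / 2) (Δ / 2)) := by
    intro i
    rw [ditherLaw_eq_map_pi hΔ, Measure.map_map (by fun_prop) (by fun_prop)]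
    exact (measurePreserving_eval _ i).map_eq
  refine ⟨?_, hev⟩
  refine (iIndepFun_iff_map_fun_eq_pi_map fun i => by simp only [id]; fun_prop).mpr ?_
  simp only [id, hev]
  rw [ditherLaw_eq_map_pi hΔ, Measure.map_map (by fun_prop) (by fun_prop)]
  exact Measure.map_id

lemma ae_mem_cell_ditherLaw : ∀ᵐ d ∂(ditherLaw m Δ), d ∈ cell m Δ := by
  rw [ditherLaw]
  exact Measure.ae_smul_measure (ae_restrict_mem measurableSet_cell) _

section Moments

variable {Ω : Type*} [MeasurableSpace Ω] {P : Measure Ω} {X : Ω → EuclideanSpace ℝ (Fin m)}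

lemma IsIIDUniform.integral_comp (hΔ : 0 < Δ) (hX : Measurable X) (h : IsIIDUniform Δ X P)
    {g : ℝ → ℝ} (hg : Measurable g) (i : Fin m) :
    ∫ ω, g (X ω i) ∂P = Δ⁻¹ * ∫ t in (-Δ / 2)..(Δ / 2), g t := by
  have hXi : AEMeasurable (fun ω => X ω i) P := by fun_prop
  have hmap : P.map (fun ω => X ω i) =
      ProbabilityTheory.cond (volume : Measure ℝ) (Set.Icc (-Δ / 2) (Δ / 2)) := h.2 i
  rw [← integral_map (φ := fun ω => X ω i) hXi hg.aestronglyMeasurable, hmap,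
    ProbabilityTheory.cond, integral_smul_measure,
    intervalIntegral.integral_of_le (by linarith), integral_Icc_eq_integral_Ioc, smul_eq_mul,
    Real.volume_Icc, show Δ / 2 - -Δ / 2 = Δ by ring, ENNReal.toReal_inv,
    ENNReal.toReal_ofReal hΔ.le]

lemma IsIIDUniform.integral_comp_mul_comp [IsProbabilityMeasure P] (hX : Measurable X)
    (h : IsIIDUniform Δ X P) {g₁ g₂ : ℝ → ℝ} (hg₁ : Measurable g₁) (hg₂ : Measurable g₂)
    {i j : Fin m} (hij : i ≠ j) :
    ∫ ω, g₁ (X ω i) * g₂ (X ω j) ∂P = (∫ ω, g₁ (X ω i) ∂P) * ∫ ω, g₂ (X ω j) ∂P :=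
  ((h.1.indepFun hij).comp hg₁ hg₂).integral_fun_mul_eq_mul_integral
    (hg₁.comp (by fun_prop)).aestronglyMeasurable (hg₂.comp (by fun_prop)).aestronglyMeasurable

lemma IsIIDUniform.ae_abs_le (hX : Measurable X) (h : IsIIDUniform Δ X P)
    (i : Fin m) : ∀ᵐ ω ∂P, |X ω i| ≤ Δ / 2 := by
  have hmap : P.map (fun ω => X ω i) =
      ProbabilityTheory.cond (volume : Measure ℝ) (Set.Icc (-Δ / 2) (Δ / 2)) := h.2 i
  have hmem : ∀ᵐ t ∂(P.map fun ω => X ω i), |t| ≤ Δ / 2 := by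
    rw [hmap, ProbabilityTheory.cond]
    refine Measure.ae_smul_measure ?_ _
    filter_upwards [ae_restrict_mem measurableSet_Icc] with t ht
    rw [abs_le]
    constructor <;> linarith [ht.1, ht.2]
  exact ae_of_ae_map (by fun_prop) hmem

lemma integral_interval_id : ∫ t in (-Δ / 2)..(Δ / 2), t = 0 := by
  rw [integral_id]
  ring

lemma integral_interval_sq : ∫ t in (-Δ / 2)..(Δ / 2), t ^ 2 = Δ ^ 3 / 12 := by
  rw [integral_pow]
  norm_num
  ring

lemma IsIIDUniform.integral_eval (hΔ : 0 < Δ) (hX : Measurable X) (h : IsIIDUniform Δ X P)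
    (i : Fin m) : ∫ ω, X ω i ∂P = 0 := by
  have := h.integral_comp hΔ hX measurable_id i
  simpa only [id, integral_interval_id, mul_zero] using this

lemma IsIIDUniform.integral_mul [IsProbabilityMeasure P] (hΔ : 0 < Δ) (hX : Measurable X)
    (h : IsIIDUniform Δ X P) (i j : Fin m) :
    Integrable (fun ω => X ω i * X ω j) P ∧
      ∫ ω, X ω i * X ω j ∂P = Matrix.diagonal (fun _ => Δ ^ 2 / 12) i j := by
  constructor
  · refine Integrable.of_bound (by fun_prop) (Δ / 2 * (Δ / 2)) ?_
    filter_upwards [h.ae_abs_le hX i, h.ae_abs_le hX j] with ω hi hj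
    rw [norm_mul]
    exact mul_le_mul hi hj (abs_nonneg _) (by positivity)
  · by_cases hij : i = j
    · subst hij
      have := h.integral_comp hΔ hX (g := fun t => t ^ 2) (by fun_prop) i
      simp_rw [← pow_two, this, integral_interval_sq, Matrix.diagonal_apply_eq]
      field_simp
    · have := h.integral_comp_mul_comp hX measurable_id measurable_id hij
      simpa [Matrix.diagonal_apply_ne _ hij, h.integral_eval hΔ hX] using this

lemma IsIIDUniform.integral_eq_zero [IsProbabilityMeasure P] (hΔ : 0 < Δ) (hX : Measurable X)
    (h : IsIIDUniform Δ X P) : ∫ ω, X ω ∂P = 0 := by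
  have hint : Integrable X P := by
    refine Integrable.of_eval_piLp fun i => Integrable.of_bound (by fun_prop) (Δ / 2) ?_
    exact h.ae_abs_le hX i
  ext i
  have := (EuclideanSpace.proj (𝕜 := ℝ) i).integral_comp_comm hint
  simp only [PiLp.proj_apply, h.integral_eval hΔ hX i] at this
  exact this.symm

end Moments

/-- A noise vector driven by the dither, entry by entry, whose strength may depend on the input. -/
def entrywise (g : ℝ → ℝ → ℝ) (y d : EuclideanSpace ℝ (Fin m)) : EuclideanSpace ℝ (Fin m) :=
  WithLp.toLp 2 fun i => g (y i) (d i)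

lemma measurable_entrywise {g : ℝ → ℝ → ℝ} (hg : Measurable (Function.uncurry g)) :
    Measurable fun p : EuclideanSpace ℝ (Fin m) × EuclideanSpace ℝ (Fin m) =>
      entrywise g p.1 p.2 := by
  have : Measurable fun (p : EuclideanSpace ℝ (Fin m) × EuclideanSpace ℝ (Fin m)) (i : Fin m) =>
      g (p.1 i) (p.2 i) :=
    measurable_pi_lambda _ fun i => hg.comp (f := fun p : EuclideanSpace ℝ (Fin m) ×
      EuclideanSpace ℝ (Fin m) => (p.1 i, p.2 i)) (by fun_prop)
  exact (WithLp.measurable_toLp 2 _).comp this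

variable {μ : Measure (EuclideanSpace ℝ (Fin m))} [IsProbabilityMeasure μ]

lemma memLp_add_entrywise (hΔ : 0 < Δ) (hμ : MemLp id 2 μ) {g : ℝ → ℝ → ℝ}
    (hg : Measurable (Function.uncurry g)) {K : ℝ}
    (hK : ∀ t, ∀ s ∈ Set.Icc (-Δ / 2) (Δ / 2), |g t s| ≤ K) :
    MemLp (fun p : EuclideanSpace ℝ (Fin m) × EuclideanSpace ℝ (Fin m) =>
      p.1 + entrywise g p.1 p.2) 2 (μ.prod (ditherLaw m Δ)) := by
  have := isProbabilityMeasure_ditherLaw (m := m) hΔ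
  have h1 : MemLp (fun p : EuclideanSpace ℝ (Fin m) × EuclideanSpace ℝ (Fin m) => p.1) 2
      (μ.prod (ditherLaw m Δ)) := hμ.comp_measurePreserving measurePreserving_fst
  refine h1.add (MemLp.of_eval_piLp fun i => ?_)
  have hm := measurable_entrywise (m := m) hg
  refine MemLp.of_bound (Measurable.aestronglyMeasurable (by fun_prop)) K ?_
  filter_upwards [Measure.quasiMeasurePreserving_snd.ae
    (ae_mem_cell_ditherLaw (m := m) (Δ := Δ))] with p hp
  exact hK _ _ (Set.Ico_subset_Icc_self (hp i))

/-- For fixed `y` the noise entries are independent and centred, so linear terms and off-diagonal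
products integrate to `0`. Only the variances remain, weighted by the nonnegative diagonal of `A`.
The bound `K` serves integrability alone. -/
lemma integral_quadForm_add_entrywise_le (hΔ : 0 < Δ) {g : ℝ → ℝ → ℝ}
    (hg : Measurable (Function.uncurry g)) {K : ℝ}
    (hK : ∀ t, ∀ s ∈ Set.Icc (-Δ / 2) (Δ / 2), |g t s| ≤ K)
    (hmean : ∀ t, ∫ s in (-Δ / 2)..(Δ / 2), g t s = 0) {c : ℝ}
    (hc : ∀ t, Δ⁻¹ * ∫ s in (-Δ / 2)..(Δ / 2), g t s ^ 2 ≤ c)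
    {A : Matrix (Fin m) (Fin m) ℝ} (hA : A.PosSemidef) (v y : EuclideanSpace ℝ (Fin m)) :
    ∫ d, quadForm A (v + entrywise g y d) ∂(ditherLaw m Δ) ≤ quadForm A v + c * A.trace := by
  have := isProbabilityMeasure_ditherLaw (m := m) hΔ
  have hU := isIIDUniform_id (m := m) hΔ
  have hgt : ∀ t, Measurable (g t) := fun t => hg.of_uncurry_left
  have hbd : ∀ i, ∀ᵐ d ∂(ditherLaw m Δ), |g (y i) (d i)| ≤ K := fun i => by
    filter_upwards [ae_mem_cell_ditherLaw (m := m) (Δ := Δ)] with d hd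
    exact hK _ _ (Set.Ico_subset_Icc_self (hd i))
  have hgm : ∀ i, Measurable fun d : EuclideanSpace ℝ (Fin m) => g (y i) (d i) :=
    fun i => (hgt _).comp (by fun_prop)
  have hLp : ∀ i, MemLp (fun d : EuclideanSpace ℝ (Fin m) => g (y i) (d i)) 2 (ditherLaw m Δ) :=
    fun i => MemLp.of_bound (hgm i).aestronglyMeasurable K (hbd i)
  have hI1 : ∀ i, Integrable (fun d : EuclideanSpace ℝ (Fin m) => g (y i) (d i))
      (ditherLaw m Δ) := fun i => (hLp i).integrable (by norm_num)
  have hI2 : ∀ i j, Integrable (fun d : EuclideanSpace ℝ (Fin m) => g (y i) (d i) * g (y j) (d j))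
      (ditherLaw m Δ) := fun i j => (hLp i).integrable_mul (hLp j)
  have h0 : ∀ i, ∫ d, g (y i) (d i) ∂(ditherLaw m Δ) = 0 := fun i => by
    have := hU.integral_comp hΔ measurable_id (hgt (y i)) i
    simpa [hmean] using this
  have hprod : ∀ i j, Integrable (fun d => (v + entrywise g y d) i * (v + entrywise g y d) j)
      (ditherLaw m Δ) := fun i j =>
    ((memLp_const (v i)).add (hLp i)).integrable_mul ((memLp_const (v j)).add (hLp j))
  have hval : ∀ i j, ∫ d, (v + entrywise g y d) i * (v + entrywise g y d) j ∂(ditherLaw m Δ) =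
      v i * v j + ∫ d, g (y i) (d i) * g (y j) (d j) ∂(ditherLaw m Δ) := by
    intro i j
    have hexp : ∀ d, (v + entrywise g y d) i * (v + entrywise g y d) j =
        (v i * v j + v i * g (y j) (d j)) + (v j * g (y i) (d i) + g (y i) (d i) * g (y j) (d j)) :=
      fun d => by
        change (v i + g (y i) (d i)) * (v j + g (y j) (d j)) = _
        ring
    simp_rw [hexp]
    rw [integral_add ((integrable_const _).fun_add ((hI1 j).const_mul _))
      (((hI1 i).const_mul _).fun_add (hI2 i j)), integral_add (integrable_const _)
      ((hI1 j).const_mul _), integral_add ((hI1 i).const_mul _) (hI2 i j), integral_const]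
    simp [integral_const_mul, h0]
  rw [integral_quadForm A hprod]
  simp_rw [hval, mul_add, Finset.sum_add_distrib]
  refine add_le_add le_rfl ?_
  rw [Matrix.trace, Finset.mul_sum]
  refine Finset.sum_le_sum fun i _ => ?_
  rw [Finset.sum_eq_single i]
  · have := hU.integral_comp hΔ measurable_id (g := fun s => g (y i) s ^ 2)
      ((hgt (y i)).pow_const 2) i
    simp only [id] at this
    simp_rw [← pow_two, this, Matrix.diag_apply]
    rw [mul_comm]
    exact mul_le_mul_of_nonneg_right (hc _) hA.diag_nonneg
  · intro j _ hji
    have := hU.integral_comp_mul_comp measurable_id (hgt (y i)) (hgt (y j)) hji.symm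
    simp only [id] at this
    rw [this, h0, zero_mul, mul_zero]
  · simp

/-- Averages the fixed-`y` bound over `μ` by Fubini. It is used with `g t s = s` for plain dither
and with `roundErr` for the quantizer output. -/
lemma integral_prod_quadForm_add_entrywise_le (hΔ : 0 < Δ) (hμ : MemLp id 2 μ) {g : ℝ → ℝ → ℝ}
    (hg : Measurable (Function.uncurry g)) {K : ℝ}
    (hK : ∀ t, ∀ s ∈ Set.Icc (-Δ / 2) (Δ / 2), |g t s| ≤ K)
    (hmean : ∀ t, ∫ s in (-Δ / 2)..(Δ / 2), g t s = 0) {c : ℝ}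
    (hc : ∀ t, Δ⁻¹ * ∫ s in (-Δ / 2)..(Δ / 2), g t s ^ 2 ≤ c)
    {A : Matrix (Fin m) (Fin m) ℝ} (hA : A.PosSemidef) (a : EuclideanSpace ℝ (Fin m)) :
    ∫ p, quadForm A (p.1 + entrywise g p.1 p.2 - a) ∂(μ.prod (ditherLaw m Δ)) ≤
      ∫ y, quadForm A (y - a) ∂μ + c * A.trace := by
  have := isProbabilityMeasure_ditherLaw (m := m) hΔ
  have hI := integrable_quadForm A
    (integrable_mul_sub_of_memLp (memLp_add_entrywise hΔ hμ hg hK) a)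
  have hIμ : Integrable (fun y => quadForm A (y - a)) μ :=
    integrable_quadForm A (integrable_mul_sub_of_memLp (X := fun y => y) hμ a)
  rw [integral_prod _ hI]
  calc _ ≤ ∫ y, (quadForm A (y - a) + c * A.trace) ∂μ := by
        refine integral_mono hI.integral_prod_left (hIμ.add (integrable_const _)) fun y => ?_
        have := integral_quadForm_add_entrywise_le hΔ hg hK hmean hc hA (y - a) y
        simpa only [add_sub_right_comm] using this
    _ = _ := by
        rw [integral_add hIμ (integrable_const _), integral_const]
        simp

end

/-! ### Rounding error, Gaussian bound and conditional entropy -/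

section

variable {m : ℕ} {Δ : ℝ}

/-- The difference between the quantization of `t + s` and `t`. -/
def roundErr (Δ t s : ℝ) : ℝ := ⌊(t + s) / Δ + 1 / 2⌋ * Δ - t

lemma measurable_roundErr : Measurable (Function.uncurry (roundErr Δ)) := by
  unfold roundErr Function.uncurry
  fun_prop

lemma quantizer_add_eq (y d : EuclideanSpace ℝ (Fin m)) :
    (quantizer Δ (y + d) : EuclideanSpace ℝ (Fin m)) = y + entrywise (roundErr Δ) y d := by
  ext i
  simp [quantizer, entrywise, roundErr]

/-- The shift `s / Δ + 1 / 2` lies in `[0, 1]`, so the floor rises by at most one, even at the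
closed right endpoint. -/
lemma roundErr_eq_or (hΔ : 0 < Δ) (t : ℝ) {s : ℝ} (hs : s ∈ Set.Icc (-Δ / 2) (Δ / 2)) :
    roundErr Δ t s = ⌊t / Δ⌋ * Δ - t ∨ roundErr Δ t s = ⌊t / Δ⌋ * Δ - t + Δ := by
  have hx : (t + s) / Δ + 1 / 2 = t / Δ + (s / Δ + 1 / 2) := by ring
  have h1 : 0 ≤ s / Δ + 1 / 2 := by
    have : -(1 / 2) ≤ s / Δ := by
      rw [le_div_iff₀ hΔ]
      linarith [hs.1]
    linarith
  have h2 : s / Δ + 1 / 2 ≤ 1 := by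
    have : s / Δ ≤ 1 / 2 := by
      rw [div_le_iff₀ hΔ]
      linarith [hs.2]
    linarith
  have h3 := Int.floor_le (t / Δ)
  have h4 := Int.lt_floor_add_one (t / Δ)
  have hle : ⌊t / Δ⌋ ≤ ⌊(t + s) / Δ + 1 / 2⌋ := Int.le_floor.mpr (by rw [hx]; linarith)
  have hlt : ⌊(t + s) / Δ + 1 / 2⌋ < ⌊t / Δ⌋ + 2 := Int.floor_lt.mpr (by
    rw [hx]
    push_cast
    linarith)
  have : ⌊(t + s) / Δ + 1 / 2⌋ = ⌊t / Δ⌋ ∨ ⌊(t + s) / Δ + 1 / 2⌋ = ⌊t / Δ⌋ + 1 := by omega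
  unfold roundErr
  rcases this with h | h <;> rw [h]
  · exact Or.inl rfl
  · right
    push_cast
    ring

lemma abs_roundErr_le (hΔ : 0 < Δ) (t s : ℝ) (hs : s ∈ Set.Icc (-Δ / 2) (Δ / 2)) :
    |roundErr Δ t s| ≤ Δ := by
  have h1 : (⌊t / Δ⌋ : ℝ) * Δ ≤ t := by
    rw [← le_div_iff₀ hΔ]
    exact Int.floor_le _
  have h2 : t ≤ (⌊t / Δ⌋ + 1 : ℝ) * Δ := by
    rw [← div_le_iff₀ hΔ]
    exact (Int.lt_floor_add_one _).le
  rw [abs_le]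
  rcases roundErr_eq_or hΔ t hs with h | h <;> rw [h] <;> constructor <;> linarith

/-- With `e₀ = ⌊t / Δ⌋ Δ - t`, the error `E` satisfies `(E - e₀)(E - e₀ - Δ) = 0`, so `E²` is affine
in `E`, with constant term `-e₀ (e₀ + Δ) ≤ Δ² / 4`. Since `E` has mean zero, this bounds its
variance without computing probabilities. -/
lemma roundErr_sq_le (hΔ : 0 < Δ) (t s : ℝ) (hs : s ∈ Set.Icc (-Δ / 2) (Δ / 2)) :
    roundErr Δ t s ^ 2 ≤ (2 * (⌊t / Δ⌋ * Δ - t) + Δ) * roundErr Δ t s + Δ ^ 2 / 4 := by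
  rcases roundErr_eq_or hΔ t hs with h | h <;> rw [h] <;>
    nlinarith [sq_nonneg (2 * (⌊t / Δ⌋ * Δ - t) + Δ)]

lemma integral_fract_unit : ∫ x in (0 : ℝ)..1, Int.fract x = 1 / 2 := by
  have : ∫ x in (0 : ℝ)..1, Int.fract x = ∫ x in (0 : ℝ)..1, x := by
    refine intervalIntegral.integral_congr_ae ?_
    filter_upwards [compl_mem_ae_iff.mpr (measure_singleton (1 : ℝ))] with x hx hx'
    rw [Set.uIoc_of_le zero_le_one] at hx'
    exact Int.fract_eq_self.mpr ⟨hx'.1.le, lt_of_le_of_ne hx'.2 hx⟩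
  rw [this, integral_id]
  norm_num

lemma intervalIntegrable_roundErr (hΔ : 0 < Δ) (t : ℝ) :
    IntervalIntegrable (roundErr Δ t) volume (-Δ / 2) (Δ / 2) := by
  rw [intervalIntegrable_iff_integrableOn_Icc_of_le (by linarith)]
  refine Integrable.of_bound (measurable_roundErr.of_uncurry_left).aestronglyMeasurable Δ ?_
  filter_upwards [ae_restrict_mem measurableSet_Icc] with s hs
  exact abs_roundErr_le hΔ t s hs

/-- The difference `s + Δ / 2 - roundErr Δ t s` is `Δ` times a fractional part, and `s` runs over
exactly one period, where the fractional part has mean `1 / 2`. -/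
lemma integral_roundErr (hΔ : 0 < Δ) (t : ℝ) : ∫ s in (-Δ / 2)..(Δ / 2), roundErr Δ t s = 0 := by
  have hpt : ∀ s, Int.fract (s / Δ + (t / Δ + 1 / 2)) = (s + Δ / 2 - roundErr Δ t s) / Δ := by
    intro s
    rw [Int.fract, roundErr, show (t + s) / Δ + 1 / 2 = s / Δ + (t / Δ + 1 / 2) by ring]
    field_simp
    ring
  have hfr : ∫ s in (-Δ / 2)..(Δ / 2), Int.fract (s / Δ + (t / Δ + 1 / 2)) = Δ / 2 := by
    rw [intervalIntegral.integral_comp_div_add _ hΔ.ne',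
      show -Δ / 2 / Δ + (t / Δ + 1 / 2) = t / Δ by field_simp; ring,
      show Δ / 2 / Δ + (t / Δ + 1 / 2) = t / Δ + 1 by field_simp; ring,
      (Int.fract_periodic ℝ).intervalIntegral_add_eq (t / Δ) 0, zero_add, integral_fract_unit,
      smul_eq_mul, mul_one_div]
  simp_rw [hpt] at hfr
  have hid : IntervalIntegrable (fun s : ℝ => s + Δ / 2) volume (-Δ / 2) (Δ / 2) :=
    (by fun_prop : Continuous fun s : ℝ => s + Δ / 2).intervalIntegrable _ _
  have hcalc : ∫ s in (-Δ / 2)..(Δ / 2), (s + Δ / 2) = Δ ^ 2 / 2 := by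
    rw [intervalIntegral.integral_add (by simp) (by simp), integral_interval_id]
    simp
    ring
  rw [intervalIntegral.integral_div, intervalIntegral.integral_sub hid
    (intervalIntegrable_roundErr hΔ t), hcalc, div_eq_iff hΔ.ne'] at hfr
  linarith

lemma integral_roundErr_sq_le (hΔ : 0 < Δ) (t : ℝ) :
    Δ⁻¹ * ∫ s in (-Δ / 2)..(Δ / 2), roundErr Δ t s ^ 2 ≤ Δ ^ 2 / 4 := by
  have hsq : IntervalIntegrable (fun s => roundErr Δ t s ^ 2) volume (-Δ / 2) (Δ / 2) := by
    rw [intervalIntegrable_iff_integrableOn_Icc_of_le (by linarith)]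
    refine Integrable.of_bound
      ((measurable_roundErr.of_uncurry_left).pow_const 2).aestronglyMeasurable (Δ ^ 2) ?_
    filter_upwards [ae_restrict_mem measurableSet_Icc] with s hs
    rw [norm_pow]
    exact pow_le_pow_left₀ (norm_nonneg _) (abs_roundErr_le hΔ t s hs) 2
  have hlin := (intervalIntegrable_roundErr hΔ t).const_mul (2 * (⌊t / Δ⌋ * Δ - t) + Δ)
  have hcon : IntervalIntegrable (fun _ : ℝ => Δ ^ 2 / 4) volume (-Δ / 2) (Δ / 2) :=
    intervalIntegrable_const
  have h := intervalIntegral.integral_mono_on (by linarith) hsq (hlin.add hcon)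
    fun s hs => roundErr_sq_le hΔ t s hs
  rw [intervalIntegral.integral_add hlin hcon, intervalIntegral.integral_const_mul,
    integral_roundErr hΔ, intervalIntegral.integral_const, mul_zero, zero_add, smul_eq_mul,
    show Δ / 2 - -Δ / 2 = Δ by ring] at h
  rwa [inv_mul_le_iff₀ hΔ]

variable {μ : Measure (EuclideanSpace ℝ (Fin m))} [IsProbabilityMeasure μ]

/-- The Gaussian bound on the differential entropy of a dithered random vector. -/
lemma neg_integral_cellProb_mul_logb_le (hΔ : 0 < Δ) (hμ : MemLp id 2 μ)
    (a : EuclideanSpace ℝ (Fin m)) {S : Matrix (Fin m) (Fin m) ℝ} (hS : S.PosDef)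
    (hle : ∫ y, quadForm S⁻¹ (y - a) ∂μ + Δ ^ 2 / 12 * S⁻¹.trace ≤ m) :
    Integrable (fun x => cellProb Δ μ x / Δ ^ m * Real.logb 2 (cellProb Δ μ x / Δ ^ m)) ∧
      -∫ x, cellProb Δ μ x / Δ ^ m * Real.logb 2 (cellProb Δ μ x / Δ ^ m) ≤
        1 / 2 * Real.logb 2 ((2 * Real.pi * Real.exp 1) • S).det := by
  have := isProbabilityMeasure_ditherLaw (m := m) hΔ
  have hg : Measurable (Function.uncurry fun _ s : ℝ => s) := measurable_snd
  have hK : ∀ t : ℝ, ∀ s ∈ Set.Icc (-Δ / 2) (Δ / 2), |(fun _ s : ℝ => s) t s| ≤ Δ / 2 := by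
    intro _ s hs
    rw [abs_le]
    constructor <;> linarith [hs.1, hs.2]
  have hmem := memLp_add_entrywise hΔ hμ hg hK
  have hbound := integral_prod_quadForm_add_entrywise_le hΔ hμ hg hK
    (fun _ => integral_interval_id) (c := Δ ^ 2 / 12)
    (fun _ => by rw [integral_interval_sq]; apply le_of_eq; field_simp) hS.inv.posSemidef a
  have hconv : μ ∗ ditherLaw m Δ = (μ.prod (ditherLaw m Δ)).map
      fun p => p.1 + entrywise (fun _ s : ℝ => s) p.1 p.2 := rfl
  have hm : Measurable fun p : EuclideanSpace ℝ (Fin m) × EuclideanSpace ℝ (Fin m) =>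
      p.1 + entrywise (fun _ s : ℝ => s) p.1 p.2 := measurable_fst.add (measurable_entrywise hg)
  have hqm : Measurable fun x : EuclideanSpace ℝ (Fin m) => quadForm S⁻¹ (x - a) := by fun_prop
  -- A cell has probability at most `1`, so the density is at most `1 / Δ ^ m`.
  refine neg_integral_mul_logb_le (C := 1 / Δ ^ m) (by fun_prop)
    (fun x => div_nonneg (cellProb_nonneg x) (by positivity))
    (fun x => div_le_div_of_nonneg_right (cellProb_le_one x) (by positivity))
    (conv_ditherLaw hΔ) a hS ?_ ?_
  · rw [hconv, integrable_map_measure hqm.aestronglyMeasurable hm.aemeasurable]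
    exact integrable_quadForm _ (integrable_mul_sub_of_memLp hmem a)
  · rw [hconv, integral_map hm.aemeasurable hqm.aestronglyMeasurable]
    exact hbound.trans hle

/-- By independence, freezing the dither at `d` gives a kernel `κ` that disintegrates the joint law
of dither and output. Conditional distributions are almost everywhere unique, so `κ` may replace
`condDistrib`. -/
lemma condEntropy_quantizer_eq {Ω : Type*} [MeasurableSpace Ω] {P : Measure Ω}
    [IsProbabilityMeasure P] (hΔ : 0 < Δ) {z δ : Ω → EuclideanSpace ℝ (Fin m)}
    [Nonempty (stepLattice m Δ)]
    (hz : Measurable z) (hδ : Measurable δ) (hδz : IndepFun δ z P) :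
    condEntropy (fun ω => quantizer Δ (z ω + δ ω)) δ P =
      ∫⁻ d, pmfEntropy ((P.map z).map fun y => quantizer Δ (y + d)) ∂(P.map δ) := by
  have := Measure.isProbabilityMeasure_map (μ := P) hz.aemeasurable
  have := Measure.isProbabilityMeasure_map (μ := P) hδ.aemeasurable
  have hQ := measurable_quantizer (m := m) hΔ
  have hG : Measurable fun p : EuclideanSpace ℝ (Fin m) × EuclideanSpace ℝ (Fin m) =>
      quantizer Δ (p.2 + p.1) := hQ.comp (by fun_prop)
  let κ : Kernel (EuclideanSpace ℝ (Fin m)) (stepLattice m Δ) :=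
    (Kernel.id ×ₖ Kernel.const _ (P.map z)).map fun p => quantizer Δ (p.2 + p.1)
  have : IsMarkovKernel κ := Kernel.IsMarkovKernel.map _ hG
  have hκ : ∀ d, κ d = (P.map z).map fun y => quantizer Δ (y + d) := by
    intro d
    rw [Kernel.map_apply _ hG, Kernel.prod_apply, Kernel.id_apply, Kernel.const_apply,
      Measure.dirac_prod, Measure.map_map hG (by fun_prop)]
    rfl
  have hqm : Measurable fun ω => quantizer Δ (z ω + δ ω) := hQ.comp (by fun_prop)
  have hjoint : P.map (fun ω => (δ ω, quantizer Δ (z ω + δ ω))) = P.map δ ⊗ₘ κ := by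
    have hpair := (indepFun_iff_map_prod_eq_prod_map_map hδ.aemeasurable hz.aemeasurable).mp hδz
    have hT : Measurable fun p : EuclideanSpace ℝ (Fin m) × EuclideanSpace ℝ (Fin m) =>
      (p.1, quantizer Δ (p.2 + p.1)) := measurable_fst.prodMk hG
    have hcomp : P.map (fun ω => (δ ω, quantizer Δ (z ω + δ ω))) =
        ((P.map δ).prod (P.map z)).map fun p => (p.1, quantizer Δ (p.2 + p.1)) := by
      rw [← hpair, Measure.map_map hT (hδ.prodMk hz)]
      rfl
    rw [hcomp]
    ext s hs
    rw [Measure.map_apply hT hs, Measure.prod_apply (hT hs), Measure.compProd_apply hs]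
    refine lintegral_congr fun d => ?_
    have hQd : Measurable fun y : EuclideanSpace ℝ (Fin m) => quantizer Δ (y + d) :=
      hQ.comp (by fun_prop)
    rw [hκ, Measure.map_apply hQd (measurable_prodMk_left hs)]
    rfl
  rw [condEntropy]
  refine lintegral_congr_ae ?_
  filter_upwards [condDistrib_ae_eq_of_measure_eq_compProd δ hqm.aemeasurable hjoint] with d hd
  rw [hd, hκ]

/-- Dithering a lattice-valued random vector does not change the quantizer output. -/
lemma lintegral_pmfEntropy_of_lattice (hΔ : 0 < Δ) (ν : Measure (stepLattice m Δ))
    [IsProbabilityMeasure ν] :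
    ∫⁻ d, pmfEntropy ((ν.map Subtype.val).map fun y => quantizer Δ (y + d)) ∂(ditherLaw m Δ) =
      pmfEntropy ν := by
  have := isProbabilityMeasure_ditherLaw (m := m) hΔ
  have hQ := measurable_quantizer (m := m) hΔ
  rw [lintegral_congr_ae (g := fun _ => pmfEntropy ν), lintegral_const, measure_univ, mul_one]
  filter_upwards [ae_mem_cell_ditherLaw (m := m) (Δ := Δ)] with d hd
  have hQd : Measurable fun y : EuclideanSpace ℝ (Fin m) => quantizer Δ (y + d) :=
    hQ.comp (by fun_prop)
  rw [Measure.map_map hQd measurable_subtype_coe]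
  have : (fun y : EuclideanSpace ℝ (Fin m) => quantizer Δ (y + d)) ∘ Subtype.val = id := by
    funext k
    exact (quantizer_eq_iff hΔ _ k).mpr (by simpa using hd)
  rw [this, Measure.map_id]

/-- The differential entropy of the dither. -/
lemma diffEntropy_ditherLaw {Ω : Type*} [MeasurableSpace Ω] {P : Measure Ω} (hΔ : 0 < Δ)
    {X : Ω → EuclideanSpace ℝ (Fin m)} (hX : P.map X = ditherLaw m Δ) :
    HasFiniteDiffEntropy X P ∧ diffEntropy X P = m * Real.logb 2 Δ := by
  have := isProbabilityMeasure_ditherLaw (m := m) hΔ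
  -- The dither is dithered zero, so the general density formula applies with a point mass at the
  -- origin.
  have hconv := conv_ditherLaw (μ := Measure.dirac (0 : EuclideanSpace ℝ (Fin m))) hΔ
  rw [Measure.dirac_zero_conv] at hconv
  have hf0 : ∀ x, 0 ≤ cellProb Δ (.dirac (0 : EuclideanSpace ℝ (Fin m))) x / Δ ^ m :=
    fun x => div_nonneg (cellProb_nonneg x) (by positivity)
  obtain ⟨hf1, hf2⟩ := integrable_of_withDensity (by fun_prop) hf0 hconv
  -- A point mass gives each cell probability `0` or `1`; the logarithm is `0` in both cases, since
  -- `Real.logb 2 0 = 0`.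
  have h01 : ∀ x, Real.logb 2 (cellProb Δ (.dirac (0 : EuclideanSpace ℝ (Fin m))) x) = 0 := by
    intro x
    rw [cellProb, measureReal_def, Measure.dirac_apply]
    by_cases h : (0 : EuclideanSpace ℝ (Fin m)) ∈ {y | y - x ∈ cell m Δ} <;>
      simp only [Set.indicator_of_mem, Set.indicator_of_notMem, h, not_false_eq_true] <;> simp
  rw [hasFiniteDiffEntropy_iff (by fun_prop) hf0 (hX.trans hconv),
    diffEntropy_eq (by fun_prop) hf0 (hX.trans hconv)]
  simp_rw [logb_cellProb_div hΔ, h01, mul_zero, zero_sub]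
  refine ⟨(hf1.mul_const _).neg, ?_⟩
  rw [integral_neg, neg_neg, integral_mul_const, hf2, one_mul]

end

/-! ### Determinant identities and the entropy bound without side information -/

section

variable {m : ℕ} {Δ : ℝ}

lemma posSemidef_of_covariance {Ω : Type*} [MeasurableSpace Ω] {P : Measure Ω}
    [IsProbabilityMeasure P] {z : Ω → EuclideanSpace ℝ (Fin m)} (hz2 : MemLp z 2 P)
    {Z : Matrix (Fin m) (Fin m) ℝ}
    (hZ : ∀ i j, cov[fun ω => z ω i, fun ω => z ω j; P] = Z i j) : Z.PosSemidef := by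
  refine Matrix.PosSemidef.of_dotProduct_mulVec_nonneg ?_ fun v => ?_
  · ext i j
    simp [← hZ, covariance_comm]
  · have hint := integrable_mul_sub_of_memLp hz2 (∫ ω, z ω ∂P)
    have h1 := integral_mul_sub_eq_covariance hz2 rfl
    -- The rank-one form of `v vᵀ` at the centred vector is the square of its inner product with
    -- `v`, hence nonnegative in mean.
    have h2 : star v ⬝ᵥ Z.mulVec v =
        ∫ ω, quadForm (Matrix.vecMulVec v v) (z ω - ∫ ω, z ω ∂P) ∂P := by
      rw [integral_quadForm _ hint]
      simp only [h1, hZ, dotProduct, Matrix.mulVec, Finset.mul_sum, Matrix.vecMulVec_apply]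
      exact Finset.sum_congr rfl fun i _ => Finset.sum_congr rfl fun j _ => by simp; ring
    rw [h2]
    refine integral_nonneg fun ω => quadForm_nonneg ?_ _
    simpa using Matrix.posSemidef_vecMulVec_self_star v

lemma sum_mul_add_diagonal (A Z : Matrix (Fin m) (Fin m) ℝ) (c : ℝ) :
    ∑ i, ∑ j, A i j * (Z + Matrix.diagonal fun _ => c : Matrix (Fin m) (Fin m) ℝ) i j =
      ∑ i, ∑ j, A i j * Z i j + c * A.trace := by
  simp_rw [Matrix.add_apply, mul_add, Finset.sum_add_distrib, Matrix.trace, Finset.mul_sum]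
  congr 1
  refine Finset.sum_congr rfl fun i _ => ?_
  simp [Matrix.diagonal_apply, mul_comm]

/-- The two `2πe/12` contributions cancel, which leaves minus the differential entropy of the
dither. -/
lemma logb_det_smul_diagonal (hΔ : 0 < Δ) :
    -(1 / 2 * Real.logb 2
        ((2 * Real.pi * Real.exp 1) • (Matrix.diagonal fun _ : Fin m => Δ ^ 2 / 12)).det) +
      (m : ℝ) / 2 * Real.logb 2 (2 * Real.pi * Real.exp 1 / 12) = -(m * Real.logb 2 Δ) := by
  rw [Matrix.det_smul, Matrix.det_diagonal, Finset.prod_const, Finset.card_univ, Fintype.card_fin,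
    ← mul_pow, show 2 * Real.pi * Real.exp 1 * (Δ ^ 2 / 12) =
      (2 * Real.pi * Real.exp 1 / 12) * Δ ^ 2 by ring, Real.logb_pow,
    Real.logb_mul (by positivity) (by positivity), Real.logb_pow]
  push_cast
  ring

lemma logb_det_four_smul {S : Matrix (Fin m) (Fin m) ℝ} (hS : S.PosDef) :
    1 / 2 * Real.logb 2 ((2 * Real.pi * Real.exp 1) • ((4 : ℝ) • S)).det =
      1 / 2 * Real.logb 2 ((2 * Real.pi * Real.exp 1) • S).det + m := by
  have := hS.det_pos
  rw [smul_comm, Matrix.det_smul, Fintype.card_fin, Real.logb_mul (by positivity)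
    (by rw [Matrix.det_smul]; positivity), show (4 : ℝ) = 2 ^ 2 by norm_num, ← pow_mul,
    Real.logb_pow, Real.logb_self_eq_one one_lt_two]
  push_cast
  ring

/-- The Gaussian bound on the entropy of the output of the dithered quantizer, without the dither
as side information. -/
lemma entropy_quantizer_le {Ω : Type*} [MeasurableSpace Ω] {P : Measure Ω}
    [IsProbabilityMeasure P] (hΔ : 0 < Δ) {z δ : Ω → EuclideanSpace ℝ (Fin m)}
    (hz : Measurable z) (hz2 : MemLp z 2 P) (hδ : Measurable δ) (hδu : IsIIDUniform Δ δ P)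
    (hδz : IndepFun δ z P) {Z : Matrix (Fin m) (Fin m) ℝ}
    (hZ : ∀ i j, cov[fun ω => z ω i, fun ω => z ω j; P] = Z i j)
    (hS : (Z + Matrix.diagonal fun _ => Δ ^ 2 / 12).PosDef) :
    (entropy (fun ω => quantizer Δ (z ω + δ ω)) P : EReal) ≤
      ((1 / 2 * Real.logb 2 ((2 * Real.pi * Real.exp 1) •
        (Z + Matrix.diagonal fun _ => Δ ^ 2 / 12)).det + m - m * Real.logb 2 Δ : ℝ) : EReal) := by
  set S := Z + Matrix.diagonal fun _ => Δ ^ 2 / 12 with hSdef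
  set a := ∫ ω, z ω ∂P with ha
  have := isProbabilityMeasure_ditherLaw (m := m) hΔ
  have := Measure.isProbabilityMeasure_map (μ := P) hz.aemeasurable
  have hQ := measurable_quantizer (m := m) hΔ
  have hqm : Measurable fun ω => quantizer Δ (z ω + δ ω) := hQ.comp (by fun_prop)
  set ν := P.map fun ω => quantizer Δ (z ω + δ ω) with hν
  have : IsProbabilityMeasure ν := Measure.isProbabilityMeasure_map hqm.aemeasurable
  have : IsProbabilityMeasure (ν.map Subtype.val) :=
    Measure.isProbabilityMeasure_map measurable_subtype_coe.aemeasurable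
  have hlaw : MemLp id 2 (P.map z) :=
    (memLp_map_measure_iff aestronglyMeasurable_id hz.aemeasurable).mpr hz2
  have hpair : P.map (fun ω => (z ω, δ ω)) = (P.map z).prod (ditherLaw m Δ) := by
    rw [(indepFun_iff_map_prod_eq_prod_map_map hz.aemeasurable hδ.aemeasurable).mp hδz.symm,
      hδu.map_eq hΔ hδ]
  have hm : Measurable fun p : EuclideanSpace ℝ (Fin m) × EuclideanSpace ℝ (Fin m) =>
      p.1 + entrywise (roundErr Δ) p.1 p.2 :=
    measurable_fst.add (measurable_entrywise measurable_roundErr)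
  have hνlaw : ν.map Subtype.val = ((P.map z).prod (ditherLaw m Δ)).map
      fun p => p.1 + entrywise (roundErr Δ) p.1 p.2 := by
    rw [hν, ← hpair, Measure.map_map measurable_subtype_coe hqm, Measure.map_map hm (hz.prodMk hδ)]
    congr 1
    funext ω
    exact quantizer_add_eq _ _
  have hK := abs_roundErr_le hΔ
  have hmem : MemLp id 2 (ν.map Subtype.val) := by
    rw [hνlaw]
    exact (memLp_map_measure_iff aestronglyMeasurable_id hm.aemeasurable).mpr
      (memLp_add_entrywise hΔ hlaw measurable_roundErr hK)
  have hA : S⁻¹.PosSemidef := hS.inv.posSemidef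
  have hqf : ∀ B : Matrix (Fin m) (Fin m) ℝ,
      Measurable fun x : EuclideanSpace ℝ (Fin m) => quadForm B (x - a) := fun B => by fun_prop
  have hqz : ∫ y, quadForm S⁻¹ (y - a) ∂(P.map z) = ∑ i, ∑ j, S⁻¹ i j * Z i j := by
    rw [integral_map hz.aemeasurable (hqf _).aestronglyMeasurable,
      integral_quadForm _ (integrable_mul_sub_of_memLp hz2 a)]
    simp_rw [integral_mul_sub_eq_covariance hz2 ha.symm, hZ]
  have hqz0 : 0 ≤ ∫ y, quadForm S⁻¹ (y - a) ∂(P.map z) :=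
    integral_nonneg fun y => quadForm_nonneg hA _
  have htr := sum_inv_mul_self hS
  rw [hSdef, sum_mul_add_diagonal, ← hSdef, ← hqz] at htr
  have hbound := integral_prod_quadForm_add_entrywise_le hΔ hlaw measurable_roundErr hK
    (integral_roundErr hΔ) (integral_roundErr_sq_le hΔ) hA a
  rw [← integral_map (f := fun x => quadForm S⁻¹ (x - a)) hm.aemeasurable
    (hqf _).aestronglyMeasurable, ← hνlaw] at hbound
  have hinv : ((4 : ℝ) • S)⁻¹ = (4 : ℝ)⁻¹ • S⁻¹ :=
    Matrix.inv_eq_right_inv (by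
      rw [smul_mul_smul_comm, Matrix.mul_nonsing_inv _ hS.det_pos.ne'.isUnit]
      norm_num)
  have hquad4 : ∀ v, quadForm ((4 : ℝ)⁻¹ • S⁻¹) v = (4 : ℝ)⁻¹ * quadForm S⁻¹ v := fun v => by
    simp only [quadForm, Matrix.smul_apply, smul_eq_mul, Finset.mul_sum, mul_assoc]
  -- With `Q` the mean form under `z` and `t = tr S⁻¹`, `htr` reads `Q + Δ² t / 12 = m`. The left
  -- side is at most `(Q + Δ² t / 4) / 4 + Δ² t / 48 = Q / 4 + Δ² t / 12`, which is at most `m`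
  -- because `Q ≥ 0`. The factor `4` makes the trace terms match exactly.
  have hle : ∫ y, quadForm ((4 : ℝ) • S)⁻¹ (y - a) ∂(ν.map Subtype.val) +
      Δ ^ 2 / 12 * ((4 : ℝ) • S)⁻¹.trace ≤ m := by
    simp_rw [hinv, hquad4]
    rw [integral_const_mul, Matrix.trace_smul, smul_eq_mul]
    linarith
  obtain ⟨hI, hH⟩ := neg_integral_cellProb_mul_logb_le hΔ hmem a
    (hS.smul (by norm_num : (0 : ℝ) < 4)) hle
  obtain ⟨h0, heq⟩ := lintegral_pmfEntropy_quantizer_eq_ofReal hΔ hI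
  -- The dither averaged over here is the fresh second one; `δ` is already absorbed in the law `ν`
  -- of the output.
  rw [lintegral_pmfEntropy_of_lattice hΔ] at heq
  rw [logb_det_four_smul hS] at hH
  change ((pmfEntropy ν : ℝ≥0∞) : EReal) ≤ _
  rw [heq, EReal.coe_ennreal_ofReal, max_eq_left h0, EReal.coe_le_coe_iff]
  linarith

end

end DitheredQuantization

end

/-! ### The main theorem -/

open DitheredQuantization in
theorem proposition1 {m : ℕ} {Δ : ℝ} (hΔ : 0 < Δ)
    {Ω : Type*} [MeasurableSpace Ω] {P : Measure Ω} [IsProbabilityMeasure P]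
    -- the input, the dither, the quantizer output
    {z δ : Ω → EuclideanSpace ℝ (Fin m)} {q : Ω → stepLattice m Δ}
    (hz : Measurable z) (hz2 : MemLp z 2 P)
    (hδ : Measurable δ) (hδu : IsIIDUniform Δ δ P) (hδz : IndepFun δ z P)
    (hq : q = fun ω => quantizer Δ (z ω + δ ω))
    -- the additive uniform noise and the noisy input
    {n r : Ω → EuclideanSpace ℝ (Fin m)}
    (hn : Measurable n) (hnu : IsIIDUniform Δ n P) (hnz : IndepFun n z P)
    (hr : r = fun ω => z ω + n ω)
    -- the mean and covariance of `z`, and the matrix `N`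
    {zμ : EuclideanSpace ℝ (Fin m)} {Z N : Matrix (Fin m) (Fin m) ℝ}
    (hzμ : ∫ ω, z ω ∂P = zμ)
    (hZ : ∀ i j, cov[fun ω => z ω i, fun ω => z ω j; P] = Z i j)
    (hN : N = Matrix.diagonal fun _ => Δ ^ 2 / 12)
    -- the Gaussian versions, possibly on another probability space
    {Ω' : Type*} [MeasurableSpace Ω'] {P' : Measure Ω'} [IsProbabilityMeasure P']
    {zG nG rG : Ω' → EuclideanSpace ℝ (Fin m)}
    (hzG : HasLaw zG (multivariateGaussian zμ Z) P')
    (hnG : HasLaw nG (multivariateGaussian 0 N) P')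
    (hzGnG : IndepFun zG nG P')
    (hrG : rG = fun ω => zG ω + nG ω) :
    -- `N` is the second moment matrix of the centred vector `n`
    (∫ ω, n ω ∂P = 0 ∧
      ∀ i j, Integrable (fun ω => n ω i * n ω j) P ∧ ∫ ω, n ω i * n ω j ∂P = N i j) ∧
    -- law and differential entropy of `rG`
    HasLaw rG (multivariateGaussian zμ (Z + N)) P' ∧
    HasFiniteDiffEntropy rG P' ∧
    diffEntropy rG P' =
      1 / 2 * Real.logb 2 ((2 * Real.pi * Real.exp 1) • (N + Z)).det ∧
    -- conditional entropy given the dither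
    HasFiniteDiffEntropy r P ∧
    HasFiniteDiffEntropy n P ∧
    (condEntropy q δ P : EReal) = ((diffEntropy r P - diffEntropy n P : ℝ) : EReal) ∧
    diffEntropy r P - diffEntropy n P ≤
      diffEntropy rG P' - 1 / 2 * Real.logb 2 ((2 * Real.pi * Real.exp 1) • N).det
        + (m : ℝ) / 2 * Real.logb 2 (2 * Real.pi * Real.exp 1 / 12) ∧
    -- entropy without the dither as side information
    (entropy q P : EReal) ≤
      ((diffEntropy rG P' - 1 / 2 * Real.logb 2 ((2 * Real.pi * Real.exp 1) • N).det
        + (m : ℝ) * (1 + 1 / 2 * Real.logb 2 (2 * Real.pi * Real.exp 1 / 12)) : ℝ) : EReal) := by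
  subst hq hr hrG hN
  have hZpsd := posSemidef_of_covariance hz2 hZ
  have hNpd : (Matrix.diagonal fun _ : Fin m => Δ ^ 2 / 12).PosDef :=
    Matrix.PosDef.diagonal fun _ => by positivity
  -- The noise matrix alone makes the sum nondegenerate, so `Z` may be singular.
  have hS : (Z + Matrix.diagonal fun _ => Δ ^ 2 / 12).PosDef :=
    Matrix.PosDef.posSemidef_add hZpsd hNpd
  have hlawG : P'.map (fun ω => zG ω + nG ω) =
      multivariateGaussian zμ (Z + Matrix.diagonal fun _ => Δ ^ 2 / 12) := by
    have h := hzGnG.map_add_eq_map_conv_map₀ hzG.aemeasurable hnG.aemeasurable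
    rw [hzG.map_eq, hnG.map_eq, multivariateGaussian_conv hZpsd hNpd.posSemidef, add_zero] at h
    exact h
  obtain ⟨hGfin, hGent⟩ := diffEntropy_multivariateGaussian hS hlawG
  have := Measure.isProbabilityMeasure_map (μ := P) hz.aemeasurable
  have hlaw : MemLp id 2 (P.map z) :=
    (memLp_map_measure_iff aestronglyMeasurable_id hz.aemeasurable).mpr hz2
  have hlawr : P.map (fun ω => z ω + n ω) =
      volume.withDensity fun x => ENNReal.ofReal (cellProb Δ (P.map z) x / Δ ^ m) := by
    rw [← conv_ditherLaw hΔ, ← hnu.map_eq hΔ hn]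
    exact hnz.symm.map_add_eq_map_conv_map hz hn
  -- Holds with equality: the left side is `tr (S⁻¹ (Z + N)) = m`.
  have hle : ∫ y, quadForm (Z + Matrix.diagonal fun _ => Δ ^ 2 / 12)⁻¹ (y - zμ) ∂(P.map z) +
      Δ ^ 2 / 12 * (Z + Matrix.diagonal fun _ => Δ ^ 2 / 12)⁻¹.trace ≤ m := by
    rw [integral_map hz.aemeasurable (Measurable.aestronglyMeasurable (by fun_prop)),
      integral_quadForm _ (integrable_mul_sub_of_memLp hz2 zμ)]
    simp_rw [integral_mul_sub_eq_covariance hz2 hzμ, hZ]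
    rw [← sum_mul_add_diagonal, sum_inv_mul_self hS]
  obtain ⟨hI, hH⟩ := neg_integral_cellProb_mul_logb_le hΔ hlaw zμ hS hle
  obtain ⟨h0, heq⟩ := lintegral_pmfEntropy_quantizer_eq_ofReal hΔ hI
  have hf0 : ∀ x, 0 ≤ cellProb Δ (P.map z) x / Δ ^ m :=
    fun x => div_nonneg (cellProb_nonneg x) (by positivity)
  obtain ⟨hnfin, hnent⟩ := diffEntropy_ditherLaw hΔ (hnu.map_eq hΔ hn)
  have hrent := diffEntropy_eq (by fun_prop) hf0 hlawr
  have hNlog := logb_det_smul_diagonal (m := m) hΔ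
  refine ⟨⟨hnu.integral_eq_zero hΔ hn, hnu.integral_mul hΔ hn⟩,
    ⟨hzG.aemeasurable.add hnG.aemeasurable, hlawG⟩, hGfin, ?_,
    (hasFiniteDiffEntropy_iff (by fun_prop) hf0 hlawr).mpr hI, hnfin, ?_, ?_, ?_⟩
  · rw [hGent, add_comm Z]
  · rw [condEntropy_quantizer_eq hΔ hz hδ hδz, hδu.map_eq hΔ hδ, heq, EReal.coe_ennreal_ofReal,
      max_eq_left h0, hrent, hnent]
  · rw [hrent, hnent, hGent]
    linarith
  · refine (entropy_quantizer_le hΔ hz hz2 hδ hδu hδz hZ hS).trans ?_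
    rw [EReal.coe_le_coe_iff, hGent]
    linarith
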